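/- Let $X_1,X_2,\dots$ be iid real random variables with distribution function $F$ and quantile function $Q(p)=\inf\{x: F(x)\ge p\}$. Let $\gamma>-1/2$ and $\rho\le 0$. Assume that $F$ is twice differentiable on $\{x>x_0: F(x)<1\}$ for some $x_0$ with $F(x_0)<1$, that $Q$ is twice differentiable on a left neighbourhood of $1$, and put $$A(t)=\frac{Q''(1-1/t)/t-2Q'(1-1/t)}{Q'(1-1/t)}+1-\gamma .$$ Assume that $A(t)\to0$ as $t\to\infty$, that $|A|$ is regularly varying at infinity with index $\rho$, and that there is an eventually positive scaling function $a$ such that for all $x>0$ $$\lim_{u\downarrow 0}\frac1{A(1/u)}\left(\frac{Q(1-ux)-Q(1-u)}{a(1/u)}-\frac{x^{-\gamma}-1}{\gamma}\right)=\int_1^{1/x}v^{\gamma-1}\int_1^v r^{\rho-1}\,dr\,dv .$$ Here and below expressions with $\gamma$ in the denominator are read as their limits when $\gamma=0$. Let $k=k_n<n$ be integers (for large $n$) with $k\to\infty$ and $k/n\to0$, let $0<\nu_n\le k$, $\tau_I=1-k/n$, $\tau_E=1-\nu_n/n$, $t_E=Q(\tau_E)$, and let $\tau^\star=(1-\tau_E)/(1-\tau_I)\to\tau_0\in[0,1]$.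 If $\rho=\tau_0=0$, assume that $|A|$ is nonincreasing near infinity. Let $w_\gamma(x)=\log x$ if $\gamma>0$, $w_\gamma(x)=\log^2x$ if $\gamma=0$, $w_\gamma(x)=x^{-\gamma}$ if $\gamma<0$, and assume $A(n/k)\,w_\gamma(1/\tau^\star)\to0$ and $\sqrt k\,|A(n/k)|\to\lambda\in(0,\infty)$. Let $X_{1,n}\le\dots\le X_{n,n}$ be the order statistics of $X_1,\dots,X_n$, and let $\widehat\gamma_n,\widehat\sigma_n$ be measurable functions of $(X_{n-k,n},\dots,X_{n,n})$ with $\widehat\gamma_n-\gamma=O_{\mathbb P}(1/\sqrt k)$ and $\widehat\sigma_n/a(n/k)-1=O_{\mathbb P}(1/\sqrt k)$. Let $h_{(\gamma,\sigma)}(x)=\sigma^{-1}(1+\gamma x/\sigma)^{-1/\gamma-1}$ be the generalized Pareto density, supported on $x>0$ (and $x<-\sigma/\gamma$ if $\gamma<0$), and define the frequentist predictive density $$\widehat h^{(F)}_{\tau_E}(y)=h_{(\widehat\gamma_n,\widehat\sigma_n)}\!\left((y-X_{n-k,n})\,{\tau^\star}^{\widehat\gamma_n}-\widehat\sigma_n\frac{1-{\tau^\star}^{\widehat\gamma_n}}{\widehat\gamma_n}\right){\tau^\star}^{\widehat\gamma_n}.$$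 Let $\alpha\in(0,1)$ and, for each $n$, let $\mathcal P_{\tau_E}\subset\mathbb R$ be a (jointly) measurable region depending on the sample $(X_1,\dots,X_n)$ such that, for all large $n$, almost surely $\int_{\mathcal P_{\tau_E}}\widehat h^{(F)}_{\tau_E}(y)\,dy=1-\alpha$. Let $\epsilon_n>0$ satisfy $\epsilon_n\to0$, $k\epsilon_n^2\to\infty$ and $\epsilon_n w_\gamma(1/\tau^\star)\to0$. Write $C_n=\mathbb P(X_{n+1}\in\mathcal P_{\tau_E}\mid X_{n+1}>t_E,\;X_1,\dots,X_n)$. Then: 1. if $\gamma<0$ or $\tau_0<1$, then $C_n=1-\alpha+O_{\mathbb P}\big(\sqrt{\epsilon_n w_\gamma(1/\tau^\star)}\big)$; 2. in all cases (including $\tau_0=1$), $C_n=1-\alpha+O_{\mathbb P}\big(\sqrt{\epsilon_n w_\gamma(1/\tau^\star)+1/\sqrt k}\,\big)$; 3. in particular $C_n\to1-\alpha$ in probability. -/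

import Mathlib

open MeasureTheory ProbabilityTheory Filter Topology

noncomputable section

namespace TailPrediction

/-! ### Tail behaviour of a distribution function -/

/-- The left-continuous inverse `F^←(τ) = inf {x : F x ≥ τ}`. -/
def quantile (F : ℝ → ℝ) (τ : ℝ) : ℝ := sInf {x : ℝ | τ ≤ F x}

/-- `g` is regularly varying at infinity with index `ρ`. -/
def RegularlyVaryingAtTop (g : ℝ → ℝ) (ρ : ℝ) : Prop :=
  ∀ x : ℝ, 0 < x → Tendsto (fun t => g (t * x) / g t) atTop (𝓝 (x ^ ρ))

/-- `𝒬_γ(x) = (x^{-γ} - 1) / γ`, read as `-log x` when `γ = 0`. -/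
def gpQuantile (γ x : ℝ) : ℝ :=
  if γ = 0 then -Real.log x else (x ^ (-γ) - 1) / γ

/-- The second-order condition on the quantile function `Q`, with scaling function `a`, rate
function `A`, tail index `γ` and second-order parameter `ρ`. -/
def SecondOrderCondition (Q a A : ℝ → ℝ) (γ ρ : ℝ) : Prop :=
  (∀ᶠ t in atTop, 0 < a t) ∧
  Tendsto A atTop (𝓝 0) ∧
  ρ ≤ 0 ∧
  RegularlyVaryingAtTop (fun t => |A t|) ρ ∧
  ∀ x : ℝ, 0 < x →
    Tendsto
      (fun u => 1 / A (1 / u) *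
        ((Q (1 - u * x) - Q (1 - u)) / a (1 / u) - gpQuantile γ x))
      (𝓝[>] 0)
      (𝓝 (∫ v in (1 : ℝ)..(1 / x), v ^ (γ - 1) * ∫ r in (1 : ℝ)..v, r ^ (ρ - 1)))

/-- The von Mises rate function
`A(t) = (Q''(1 - 1/t) / t - 2 Q'(1 - 1/t)) / Q'(1 - 1/t) + 1 - γ`. -/
def vonMisesRate (Q : ℝ → ℝ) (γ t : ℝ) : ℝ :=
  (deriv (deriv Q) (1 - 1 / t) / t - 2 * deriv Q (1 - 1 / t)) / deriv Q (1 - 1 / t) + 1 - γ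

/-- `f` is twice differentiable at `x`. -/
def TwiceDifferentiableAt (f : ℝ → ℝ) (x : ℝ) : Prop :=
  (∀ᶠ y in 𝓝 x, DifferentiableAt ℝ f y) ∧ DifferentiableAt ℝ (deriv f) x

/-- The second-order condition of von Mises type for the distribution function `F`: both `F` (to
the left of its right end-point) and its quantile function (to the left of `1`) are twice
differentiable, and the second-order condition holds with the von Mises rate function. -/
def VonMisesSecondOrder (F a : ℝ → ℝ) (γ ρ : ℝ) : Prop :=
  (∃ x₀ : ℝ, F x₀ < 1 ∧ ∀ x : ℝ, x₀ < x → F x < 1 → TwiceDifferentiableAt F x) ∧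
  (∀ᶠ p in 𝓝[<] (1 : ℝ), TwiceDifferentiableAt (quantile F) p) ∧
  SecondOrderCondition (quantile F) a (vonMisesRate (quantile F) γ) γ ρ

/-- The factor `w_γ` in the rate. -/
def rateWeight (γ x : ℝ) : ℝ :=
  if 0 < γ then Real.log x else if γ = 0 then Real.log x ^ 2 else x ^ (-γ)

/-! ### Generalized Pareto densities -/

/-- The standard generalized Pareto density `h_γ`, supported on `(0, ∞)` if `γ ≥ 0` and on
`(0, -1/γ)` if `γ < 0`. -/
def gpDensity (γ x : ℝ) : ℝ :=
  open scoped Classical in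
  if 0 < x ∧ (γ < 0 → x < -1 / γ) then
    (if γ = 0 then Real.exp (-x) else (1 + γ * x) ^ (-(1 / γ + 1)))
  else 0

/-- The generalized Pareto density with scale, `h_{(γ, σ)}(x) = h_γ(x / σ) / σ`. -/
def gpDensityScaled (γ σ x : ℝ) : ℝ := gpDensity γ (x / σ) / σ

/-- The predictive density at tail ratio `τ`, based on the threshold `u`,
`y ↦ h_{(γ, σ)}((y - u) τ^γ - σ (1 - τ^γ) / γ) τ^γ`, where `(1 - τ^γ) / γ = τ^γ 𝒬_γ(τ)` is read as
`-log τ` when `γ = 0`.  It is the derivative in `y` of the predictive distribution function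
`H_{(γ, σ)}((y - u) τ^γ - σ (1 - τ^γ) / γ)`. -/
def predictiveDensity (γ σ u τ y : ℝ) : ℝ :=
  gpDensityScaled γ σ ((y - u) * τ ^ γ - σ * (τ ^ γ * gpQuantile γ τ)) * τ ^ γ

/-! ### Samples and order statistics -/

/-- The `i`-th smallest entry `x_{i,n}` of the sample `x_1, …, x_n` (`1 ≤ i ≤ n`). -/
def orderStat {n : ℕ} (x : Fin n → ℝ) (i : ℕ) : ℝ :=
  if h : 1 ≤ i ∧ i ≤ n then x (Tuple.sort x ⟨i - 1, by omega⟩) else 0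

/-- The upper order statistics `(x_{n-k,n}, …, x_{n,n})`. -/
def topOrderStats {n : ℕ} (k : ℕ) (x : Fin n → ℝ) : Fin (k + 1) → ℝ :=
  fun i => orderStat x (n - k + i)

variable {Ω : Type*}

/-- The sample consisting of the first `n` terms of the sequence `X`; the term `X n` is then the
next, out-of-sample, observation. -/
def sample (X : ℕ → Ω → ℝ) (n : ℕ) (ω : Ω) : Fin n → ℝ := fun i => X i ω

/-- The σ-algebra generated by the sample of size `n`. -/
abbrev sampleSigma (X : ℕ → Ω → ℝ) (n : ℕ) : MeasurableSpace Ω :=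
  MeasurableSpace.comap (sample X n) inferInstance

/-- Plug-in predictive density of the peaks above the extreme threshold, from a sample `x` of
size `n`, `k` upper order statistics, estimators `T₁` of `γ` and `T₂` of `σ`, at tail
ratio `τ`. -/
def freqPredictiveDensity {n : ℕ} (k : ℕ) (T₁ T₂ : (Fin (k + 1) → ℝ) → ℝ) (τ : ℝ)
    (x : Fin n → ℝ) (y : ℝ) : ℝ :=
  predictiveDensity (T₁ (topOrderStats k x)) (T₂ (topOrderStats k x)) (orderStat x (n - k)) τ y

/-- The intermediate level `τ_I = 1 - k / n` and, with `ν` in place of `k`, the extreme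
level `τ_E = 1 - ν / n`. -/
def level (n : ℕ) (ν : ℝ) : ℝ := 1 - ν / n

/-- The tail ratio `τ⋆ = (1 - τ_E) / (1 - τ_I)`. -/
def tailRatio (n : ℕ) (k ν : ℝ) : ℝ := (1 - level n ν) / (1 - level n k)

/-! ### Stochastic boundedness and conditional coverage -/

/-- `Z_n = O_P(r_n)`. -/
def IsBigOInProbability [MeasurableSpace Ω] (P : Measure Ω) (Z : ℕ → Ω → ℝ) (r : ℕ → ℝ) : Prop :=
  ∀ η : ℝ, 0 < η → ∃ M : ℝ, 0 < M ∧
    ∀ᶠ n in atTop, P {ω | M * r n < |Z n ω|} ≤ ENNReal.ofReal η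

/-- The conditional probability, given the sample `X_1, …, X_n` and given `X_{n+1} > t`, that
`X_{n+1}` lands in the sample-dependent region `R`. -/
def conditionalCoverage [MeasurableSpace Ω] (P : Measure Ω) (X : ℕ → Ω → ℝ) (n : ℕ) (t : ℝ)
    (R : (Fin n → ℝ) → Set ℝ) : Ω → ℝ :=
  (P[|{ω | t < X n ω}])⟦{ω | X n ω ∈ R (sample X n ω)} | sampleSigma X n⟧

end TailPrediction

end

/-! In exponential scale both laws are images of one shifted exponential law. Put q(x) = Q(1 -
e^{-x}), x_n = log(n/k) and L = -log τ⋆. Above t_E = q(x_n + L) an observation is q(x_n + v) with v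
- L standard exponential, while the predictive law is that of u + σ·`boxCox c` v for the same v,
with c, σ, u the estimated index, scale and threshold. The von Mises form of A says exactly that
(log q')' = γ + A(e^x), so q(x_n + ·) is itself nearly a Box-Cox curve.

Let Δ bound the errors of c, log σ and u/σ and also |A| on the range [x_n, x_n + V]. Integrating the
logarithmic derivative and then the derivative gives q(x_n + v) = u + σ·`boxCox c` (v + y) with |y|
of order Δ times `locationWeight γ V` (`exists_abs_le_exp_mul_locationWeight`). Hence the predictive
density, pulled back along q, dominates (1 - θ) times the exponential density on L + θ < v < L + E,
with θ of the same order for V = L + E (`exists_le_predictiveDensity_mul`). Both laws have mass one,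
so this one-sided bound, used for a region and for its complement, bounds the difference of their
masses by 3θ + e^{-E}, uniformly over regions (`abs_cond_sub_setIntegral_le`). Uniformity is what
allows the region to depend on the sample.

The square root in the rate comes from the truncation level E. Running to L + E rather than L costs
a factor e^{E/2} in the bound for |A| (Potter bounds) and another in the weight, where γ > -1/2 is
used. So θ is of order e^E (1 + w)/√k, and e^{-E} = √r balances the two terms as soon as r dominates
(1 + w)/√k.

The probabilistic input is that Δ is O_P(1/√k). For c it is assumed; for σ it follows since a(n/k)
agrees with the slope q'(x_n) up to O(A) (`SecondOrderCondition.exists_abs_div_sub_one_le`); for the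
threshold it is Chebyshev's inequality for exceedance counts; for A it is the balance √k |A(n/k)| →
λ. By independence, the conditional coverage is the mass of the region under the conditional law
(`conditionalCoverage_ae_eq`). -/

namespace TailPrediction

/-! ### The Box-Cox transform and generalized Pareto densities -/

/-- The Box-Cox transform `y ↦ (exp (c y) - 1) / c`, read as `y` when `c = 0`. -/
noncomputable def boxCox (c y : ℝ) : ℝ := if c = 0 then y else (Real.exp (c * y) - 1) / c

lemma boxCox_zero (c : ℝ) : boxCox c 0 = 0 := by
  simp [boxCox]

lemma one_add_mul_boxCox (c y : ℝ) : 1 + c * boxCox c y = Real.exp (c * y) := by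
  unfold boxCox
  split_ifs with h
  · simp [h]
  · field_simp; ring

lemma hasDerivAt_boxCox (c y : ℝ) : HasDerivAt (boxCox c) (Real.exp (c * y)) y := by
  unfold boxCox
  split_ifs with h
  · subst h; simpa using hasDerivAt_id' y
  · have h1 : HasDerivAt (fun y => Real.exp (c * y)) (Real.exp (c * y) * c) y := by
      simpa using ((hasDerivAt_id y).const_mul c).exp
    have := (h1.sub_const 1).div_const c
    rwa [mul_div_cancel_right₀ _ h] at this

lemma boxCox_strictMono (c : ℝ) : StrictMono (boxCox c) :=
  strictMono_of_hasDerivAt_pos (fun y => hasDerivAt_boxCox c y) fun _ => Real.exp_pos _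

lemma boxCox_add (c x y : ℝ) : boxCox c (x + y) = boxCox c x + Real.exp (c * x) * boxCox c y := by
  unfold boxCox
  split_ifs with h
  · simp [h]
  · rw [mul_add, Real.exp_add]; field_simp; ring

lemma exists_boxCox_eq {c z : ℝ} (h : 0 < 1 + c * z) : ∃ y, boxCox c y = z := by
  by_cases hc : c = 0
  · exact ⟨z, by simp [boxCox, hc]⟩
  · refine ⟨Real.log (1 + c * z) / c, ?_⟩
    rw [boxCox, if_neg hc, mul_div_cancel₀ _ hc, Real.exp_log h]
    field_simp; ring

lemma abs_log_one_add_le {z : ℝ} (h : |z| ≤ 1 / 2) : |Real.log (1 + z)| ≤ 2 * |z| := by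
  have h' := abs_le.1 h
  have hpos : 0 < 1 + z := by linarith
  have h1 := Real.log_le_sub_one_of_pos hpos
  have h2 := Real.one_sub_inv_le_log_of_pos hpos
  have h3 : (1 + z)⁻¹ ≤ 1 + 2 * |z| := by
    rw [inv_le_iff_one_le_mul₀ hpos]
    rcases abs_cases z with ⟨h4, h5⟩ | ⟨h4, h5⟩ <;> rw [h4] <;> nlinarith
  rw [abs_le]
  constructor
  · linarith
  · linarith [le_abs_self z, abs_nonneg z]

/-- The Box-Cox transform is locally invertible at `0`, and its inverse is `2`-Lipschitz there. -/
lemma exists_boxCox_eq_abs_le {c d : ℝ} (h : |c * d| ≤ 1 / 2) :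
    ∃ y, boxCox c y = d ∧ |y| ≤ 2 * |d| := by
  by_cases hc : c = 0
  · exact ⟨d, by simp [boxCox, hc], by linarith [abs_nonneg d]⟩
  · have h' := abs_le.1 h
    have hpos : 0 < 1 + c * d := by linarith
    refine ⟨Real.log (1 + c * d) / c, ?_, ?_⟩
    · rw [boxCox, if_neg hc, mul_div_cancel₀ _ hc, Real.exp_log hpos]
      field_simp; ring
    · have hlog := abs_log_one_add_le h
      rw [abs_div, div_le_iff₀ (abs_pos.2 hc)]
      rw [abs_mul] at hlog
      linarith

lemma gpQuantile_eq_boxCox {τ : ℝ} (hτ : 0 < τ) (c : ℝ) :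
    gpQuantile c τ = boxCox c (-Real.log τ) := by
  unfold gpQuantile boxCox
  split_ifs with h
  · rfl
  · rw [Real.rpow_def_of_pos hτ]; ring_nf

lemma boxCox_mem_support {c y : ℝ} (hy : 0 < y) :
    0 < boxCox c y ∧ (c < 0 → boxCox c y < -1 / c) := by
  refine ⟨by simpa [boxCox_zero] using boxCox_strictMono c hy, fun hc => ?_⟩
  have h := one_add_mul_boxCox c y
  have h2 := Real.exp_pos (c * y)
  rw [lt_div_iff_of_neg hc]
  linarith [mul_comm c (boxCox c y)]

/-- The Jacobian of `boxCox c` is e^{cy}, so the product is e^{-y}: every generalized Pareto law is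
the image of the standard exponential law under its Box-Cox transform. -/
lemma gpDensity_boxCox {c y : ℝ} (hy : 0 < y) :
    gpDensity c (boxCox c y) = Real.exp (-((1 + c) * y)) := by
  rw [gpDensity, if_pos (boxCox_mem_support hy)]
  split_ifs with h
  · simp [boxCox, h]
  · rw [one_add_mul_boxCox, ← Real.exp_mul]
    congr 1
    field_simp

lemma gpDensity_nonneg (c x : ℝ) : 0 ≤ gpDensity c x := by
  unfold gpDensity
  split_ifs with h h0
  · positivity
  · refine Real.rpow_nonneg ?_ _
    rcases lt_or_ge c 0 with hc | hc
    · have := h.2 hc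
      rw [lt_div_iff_of_neg hc] at this
      nlinarith
    · have := h.1
      positivity
  · exact le_rfl

lemma gpDensity_eq_zero {c x : ℝ} (hx : x ∉ boxCox c '' Set.Ioi 0) : gpDensity c x = 0 := by
  unfold gpDensity
  rw [if_neg]
  rintro ⟨h1, h2⟩
  apply hx
  have h3 : 0 < 1 + c * x := by
    rcases lt_or_ge c 0 with hc | hc
    · have := h2 hc
      rw [lt_div_iff_of_neg hc] at this
      nlinarith
    · positivity
  obtain ⟨y, rfl⟩ := exists_boxCox_eq h3
  refine ⟨y, ?_, rfl⟩
  rw [← boxCox_zero c] at h1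
  exact (boxCox_strictMono c).lt_iff_lt.1 h1

lemma lintegral_gpDensity (c : ℝ) : ∫⁻ x, ENNReal.ofReal (gpDensity c x) = 1 := by
  have hcont : Continuous (boxCox c) :=
    continuous_iff_continuousAt.2 fun y => (hasDerivAt_boxCox c y).continuousAt
  have hemb : MeasurableEmbedding (boxCox c) :=
    hcont.measurableEmbedding (boxCox_strictMono c).injective
  have hms : MeasurableSet (boxCox c '' Set.Ioi 0) := hemb.measurableSet_image.2 measurableSet_Ioi
  have h1 : ∫⁻ x, ENNReal.ofReal (gpDensity c x)
      = ∫⁻ x in boxCox c '' Set.Ioi 0, ENNReal.ofReal (gpDensity c x) := by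
    rw [← lintegral_indicator hms]
    congr 1
    ext x
    by_cases hx : x ∈ boxCox c '' Set.Ioi 0
    · rw [Set.indicator_of_mem hx]
    · rw [Set.indicator_of_notMem hx, gpDensity_eq_zero hx, ENNReal.ofReal_zero]
  rw [h1, lintegral_image_eq_lintegral_abs_deriv_mul measurableSet_Ioi
    (fun y _ => (hasDerivAt_boxCox c y).hasDerivWithinAt) (boxCox_strictMono c).injective.injOn]
  have h2 : ∫⁻ y in Set.Ioi (0 : ℝ), ENNReal.ofReal |Real.exp (c * y)|
      * ENNReal.ofReal (gpDensity c (boxCox c y))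
      = ∫⁻ y in Set.Ioi (0 : ℝ), ENNReal.ofReal (Real.exp (-y)) := by
    refine setLIntegral_congr_fun measurableSet_Ioi fun y hy => ?_
    rw [gpDensity_boxCox hy, abs_of_pos (Real.exp_pos _),
      ← ENNReal.ofReal_mul (Real.exp_pos _).le, ← Real.exp_add]
    ring_nf
  rw [h2, ← ofReal_integral_eq_lintegral_ofReal (integrableOn_exp_neg_Ioi 0)
    (ae_of_all _ fun y => (Real.exp_pos _).le), integral_exp_neg_Ioi]
  simp

lemma lintegral_predictiveDensity (c u : ℝ) {σ τ : ℝ} (hσ : 0 < σ) (hτ : 0 < τ) :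
    ∫⁻ y, ENNReal.ofReal (predictiveDensity c σ u τ y) = 1 := by
  set b : ℝ := τ ^ c / σ with hb
  have hbpos : 0 < b := by positivity
  have h1 : ∀ y, ENNReal.ofReal (predictiveDensity c σ u τ y)
      = ENNReal.ofReal b * ENNReal.ofReal (gpDensity c (b * y - (b * u + τ ^ c * gpQuantile c τ))) := by
    intro y
    rw [← ENNReal.ofReal_mul hbpos.le]
    unfold predictiveDensity gpDensityScaled
    have : ((y - u) * τ ^ c - σ * (τ ^ c * gpQuantile c τ)) / σ
        = b * y - (b * u + τ ^ c * gpQuantile c τ) := by rw [hb]; field_simp; ring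
    rw [this, hb]
    congr 1
    field_simp
  simp_rw [h1]
  set d := b * u + τ ^ c * gpQuantile c τ
  have himg : (fun y : ℝ => b * y - d) '' Set.univ = Set.univ := by
    refine Set.eq_univ_of_forall fun z => ⟨(z + d) / b, trivial, ?_⟩
    change b * ((z + d) / b) - d = z
    rw [mul_div_cancel₀ _ hbpos.ne', add_sub_cancel_right]
  have h2 := lintegral_image_eq_lintegral_abs_deriv_mul (s := Set.univ)
    (f := fun y : ℝ => b * y - d) (f' := fun _ => b) MeasurableSet.univ
    (fun y _ => by
      simpa only [mul_one] using
        (((hasDerivAt_id' y).const_mul b).sub_const d).hasDerivWithinAt)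
    (fun x _ y _ h => by simpa [hbpos.ne'] using h)
    (fun z => ENNReal.ofReal (gpDensity c z))
  rw [himg, Measure.restrict_univ, lintegral_gpDensity, abs_of_pos hbpos] at h2
  exact h2.symm

lemma predictiveDensity_nonneg (c u y : ℝ) {σ τ : ℝ} (hσ : 0 < σ) (hτ : 0 < τ) :
    0 ≤ predictiveDensity c σ u τ y :=
  mul_nonneg (div_nonneg (gpDensity_nonneg _ _) hσ.le) (Real.rpow_nonneg hτ.le _)

/-- By the cocycle identity `boxCox_add`, the rescaling by τ^c and the recentring in the predictive
density only move the origin of the exponential scale to -log τ. -/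
lemma predictiveDensity_boxCox (c u : ℝ) {σ τ ℓ : ℝ} (hσ : 0 < σ) (hτ : 0 < τ)
    (hℓ : -Real.log τ < ℓ) :
    predictiveDensity c σ u τ (u + σ * boxCox c ℓ)
      = Real.exp (-Real.log τ - (1 + c) * ℓ) / σ := by
  unfold predictiveDensity gpDensityScaled
  have hpow : τ ^ c = Real.exp (c * Real.log τ) := by rw [Real.rpow_def_of_pos hτ, mul_comm]
  have hadd : boxCox c ℓ = boxCox c (-Real.log τ)
      + Real.exp (c * -Real.log τ) * boxCox c (ℓ + Real.log τ) := by
    rw [← boxCox_add]; ring_nf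
  have hexp : Real.exp (c * -Real.log τ) * Real.exp (c * Real.log τ) = 1 := by
    rw [← Real.exp_add]; simp
  have harg : ((u + σ * boxCox c ℓ - u) * τ ^ c - σ * (τ ^ c * gpQuantile c τ)) / σ
      = boxCox c (ℓ + Real.log τ) := by
    rw [gpQuantile_eq_boxCox hτ, hadd, hpow]
    generalize Real.exp (c * -Real.log τ) = e₁ at hexp ⊢
    generalize Real.exp (c * Real.log τ) = e₂ at hexp ⊢
    rw [div_eq_iff hσ.ne']
    linear_combination σ * boxCox c (ℓ + Real.log τ) * hexp
  rw [harg, gpDensity_boxCox (by linarith), hpow, div_mul_eq_mul_div, ← Real.exp_add]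
  ring_nf

/-! ### Regular variation: uniform convergence and Potter bounds -/

/-- If `G n v → 0` for every `v`, then the points `v` at which `|G n v| ≤ 1` for all `n ≥ N` fill
more than three quarters of an interval once `N` is large. -/
lemma eventually_lt_volume_of_tendsto_zero {G : ℕ → ℝ → ℝ}
    (hlim : ∀ v, Tendsto (fun n => G n v) atTop (𝓝 0)) {K : ℝ} (hK : 0 < K) :
    ∀ᶠ N in atTop, ENNReal.ofReal (3 * K / 2)
      < volume (Set.Icc 0 (2 * K) ∩ {v | ∀ n, N ≤ n → |G n v| ≤ 1}) := by
  have hmono : Monotone fun N : ℕ => Set.Icc 0 (2 * K) ∩ {v | ∀ n, N ≤ n → |G n v| ≤ 1} := by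
    intro N M hNM
    exact Set.inter_subset_inter_right _ fun v hv n hn => hv n (hNM.trans hn)
  have hU : ⋃ N : ℕ, Set.Icc 0 (2 * K) ∩ {v | ∀ n, N ≤ n → |G n v| ≤ 1} = Set.Icc 0 (2 * K) := by
    refine Set.Subset.antisymm (Set.iUnion_subset fun N => Set.inter_subset_left) fun v hv => ?_
    have h1 := (hlim v).eventually (Metric.ball_mem_nhds 0 one_pos)
    obtain ⟨N, hN⟩ := eventually_atTop.1 h1
    refine Set.mem_iUnion.2 ⟨N, hv, fun n hn => ?_⟩
    have := hN n hn
    rw [dist_zero_right, Real.norm_eq_abs] at this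
    exact this.le
  have ht := tendsto_measure_iUnion_atTop (μ := volume) hmono
  rw [hU, Real.volume_Icc] at ht
  refine ht.eventually (lt_mem_nhds ?_)
  rw [ENNReal.ofReal_lt_ofReal_iff] <;> linarith

/-- Uniform convergence theorem for additive slowly varying functions, in the form of a bound. -/
lemma eventually_forall_abs_sub_le {f : ℝ → ℝ} (hf : Measurable f) {ρ : ℝ}
    (hlim : ∀ u, Tendsto (fun x => f (x + u) - f x) atTop (𝓝 (ρ * u))) {K : ℝ} (hK : 0 < K) :
    ∀ᶠ x in atTop, ∀ u ∈ Set.Icc 0 K, |f (x + u) - f x - ρ * u| ≤ 2 := by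
  by_contra hcon
  have hex : ∀ n : ℕ, ∃ x u : ℝ, (n : ℝ) ≤ x ∧ u ∈ Set.Icc 0 K ∧ 2 < |f (x + u) - f x - ρ * u| := by
    intro n
    by_contra! h
    exact hcon (eventually_atTop.2 ⟨n, fun x hx u hu => h x u hx hu⟩)
  choose x u hx hu hbig using hex
  have hxt : Tendsto x atTop atTop := tendsto_atTop_mono hx tendsto_natCast_atTop_atTop
  have hyt : Tendsto (fun n => x n + u n) atTop atTop :=
    tendsto_atTop_mono (fun n => le_add_of_nonneg_right (hu n).1) hxt
  -- Seen from x n and from x n + u n alike, most shifts v are good, meaning that the error is at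
  -- most 1.
  have key : ∀ y : ℕ → ℝ, Tendsto y atTop atTop → ∀ᶠ N in atTop, ENNReal.ofReal (3 * K / 2)
      < volume (Set.Icc 0 (2 * K) ∩ {v | ∀ n, N ≤ n → |f (y n + v) - f (y n) - ρ * v| ≤ 1}) := by
    intro y hy
    refine eventually_lt_volume_of_tendsto_zero (G := fun n v => f (y n + v) - f (y n) - ρ * v)
      (fun v => ?_) hK
    have := ((hlim v).comp hy).sub_const (ρ * v)
    simpa using this
  obtain ⟨N, hV, hW⟩ := ((key x hxt).and (key _ hyt)).exists
  set V := Set.Icc 0 (2 * K) ∩ {v | ∀ n, N ≤ n → |f (x n + v) - f (x n) - ρ * v| ≤ 1} with hVdef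
  set W := Set.Icc 0 (2 * K) ∩
    {v | ∀ n, N ≤ n → |f (x n + u n + v) - f (x n + u n) - ρ * v| ≤ 1} with hWdef
  have hVm : MeasurableSet V := by
    refine measurableSet_Icc.inter ?_
    simp only [Set.ofPred_forall]
    refine MeasurableSet.iInter fun n => MeasurableSet.iInter fun _ => ?_
    exact measurableSet_le ((((hf.comp (measurable_const_add _)).sub_const _).sub
      (measurable_const_mul ρ)).abs) measurable_const
  -- Translating W by u N makes both sets refer to the same points x N + v. A common point would
  -- bound the increment from x N to x N + u N with error 1 + 1, against the choice of u N. So the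
  -- sets are disjoint, yet each has measure above 3K/2 and both lie in [0, 3K].
  set W' := (fun v => -u N + v) ⁻¹' W with hW'
  have hW'vol : volume W' = volume W := measure_preimage_add _ _ _
  have hdisj : Disjoint V W' := by
    rw [Set.disjoint_left]
    rintro v ⟨_, hv⟩ ⟨_, hw⟩
    have h1 := abs_le.1 (hv N le_rfl)
    have h2 := abs_le.1 (hw N le_rfl)
    rw [show x N + u N + (-u N + v) = x N + v by ring] at h2
    have h3 : |f (x N + u N) - f (x N) - ρ * u N| ≤ 2 := by
      rw [abs_le]; constructor <;> nlinarith
    exact absurd h3 (not_le.2 (hbig N))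
  have hsub : V ∪ W' ⊆ Set.Icc 0 (3 * K) := by
    rintro v (hv | hv)
    · exact ⟨hv.1.1, hv.1.2.trans (by linarith)⟩
    · have h1 := hv.1.1
      have h2 := hv.1.2
      have h3 := hu N
      exact ⟨by linarith [h3.1], by linarith [h3.2]⟩
  have hle := measure_mono (μ := volume) hsub
  rw [measure_union' hdisj hVm, hW'vol, Real.volume_Icc] at hle
  have hlt := ENNReal.add_lt_add hV hW
  rw [← ENNReal.ofReal_add (by positivity) (by positivity)] at hlt
  refine absurd (hlt.trans_le hle) (not_lt.2 (ENNReal.ofReal_le_ofReal ?_))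
  linarith

/-- Potter bound for additive slowly varying functions. -/
lemma exists_sub_le_add_mul {f : ℝ → ℝ} (hf : Measurable f) {ρ δ : ℝ} (hδ : 0 < δ)
    (hlim : ∀ u, Tendsto (fun x => f (x + u) - f x) atTop (𝓝 (ρ * u))) :
    ∃ x₀, ∀ x, x₀ ≤ x → ∀ w, 0 ≤ w → f (x + w) - f x ≤ 2 + (ρ + δ) * w := by
  have h1 : ∀ᶠ x in atTop, f (x + 1) - f x < ρ + δ :=
    (hlim 1).eventually (gt_mem_nhds (by linarith))
  obtain ⟨x₀, hx₀⟩ := eventually_atTop.1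
    (h1.and (eventually_forall_abs_sub_le hf hlim one_pos))
  refine ⟨x₀, fun x hx w hw => ?_⟩
  -- Whole steps telescope with the limit at u = 1; the fractional remainder costs the constant 2 of
  -- the uniform bound.
  have hnat : ∀ n : ℕ, f (x + n) - f x ≤ (ρ + δ) * n := by
    intro n
    induction n with
    | zero => simp
    | succ n ih =>
      have := (hx₀ (x + n) (hx.trans (by linarith [Nat.cast_nonneg (α := ℝ) n]))).1
      push_cast
      rw [← add_assoc]
      linarith
  have hfl := Nat.floor_le hw
  have hlt := Nat.lt_floor_add_one w
  have h2 := (hx₀ (x + ⌊w⌋₊) (hx.trans (by linarith [Nat.cast_nonneg (α := ℝ) ⌊w⌋₊]))).2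
    (w - ⌊w⌋₊) ⟨by linarith, by linarith⟩
  rw [show x + (⌊w⌋₊ : ℝ) + (w - ⌊w⌋₊) = x + w by ring] at h2
  have h3 := (abs_le.1 h2).2
  have h4 := hnat ⌊w⌋₊
  have h5 : 0 ≤ δ * (w - ⌊w⌋₊) := mul_nonneg hδ.le (by linarith)
  linarith

/-- At x = 1 the quotient g t / g t tends to 1, whereas the convention 0 / 0 = 0 makes it vanish at
zeros of g. -/
lemma RegularlyVaryingAtTop.eventually_ne {g : ℝ → ℝ} {ρ : ℝ} (h : RegularlyVaryingAtTop g ρ) :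
    ∀ᶠ t in atTop, g t ≠ 0 := by
  have h1 := h 1 one_pos
  rw [Real.one_rpow] at h1
  filter_upwards [h1.eventually (lt_mem_nhds zero_lt_one)] with t ht h0
  simp [h0] at ht

/-- Potter bound. -/
lemma RegularlyVaryingAtTop.exists_le_mul_exp {A : ℝ → ℝ} {ρ δ : ℝ} (hA : Measurable A)
    (h : RegularlyVaryingAtTop (fun t => |A t|) ρ) (hδ : 0 < δ) :
    ∃ C t₀ : ℝ, 0 < C ∧ 0 < t₀ ∧ ∀ t, t₀ ≤ t → ∀ w, 0 ≤ w →
      |A (t * Real.exp w)| ≤ C * Real.exp ((ρ + δ) * w) * |A t| := by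
  obtain ⟨T, hT⟩ := eventually_atTop.1 h.eventually_ne
  have hmeas : Measurable fun x => Real.log |A (Real.exp x)| :=
    Real.measurable_log.comp ((hA.comp Real.measurable_exp).abs)
  obtain ⟨x₀, hx₀⟩ := exists_sub_le_add_mul (f := fun x => Real.log |A (Real.exp x)|) (ρ := ρ)
    hmeas hδ (by
      intro u
      have h1 := (h (Real.exp u) (Real.exp_pos u)).comp Real.tendsto_exp_atTop
      have h2 := h1.log (Real.rpow_pos_of_pos (Real.exp_pos u) ρ).ne'
      rw [Real.log_rpow (Real.exp_pos u), Real.log_exp] at h2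
      refine h2.congr' ?_
      have h3 : ∀ᶠ x in atTop, T ≤ Real.exp x :=
        Real.tendsto_exp_atTop.eventually (eventually_ge_atTop T)
      have h4 : ∀ᶠ x in atTop, T ≤ Real.exp (x + u) :=
        (Real.tendsto_exp_atTop.comp (tendsto_atTop_add_const_right _ u tendsto_id)).eventually
          (eventually_ge_atTop T)
      filter_upwards [h3, h4] with x hx hxu
      simp only [Function.comp]
      rw [← Real.exp_add, Real.log_div (hT _ hxu) (hT _ hx)])
  refine ⟨Real.exp 2, max 1 (max T (Real.exp x₀)), Real.exp_pos 2, by positivity,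
    fun t ht w hw => ?_⟩
  have ht1 : 0 < t := lt_of_lt_of_le one_pos ((le_max_left _ _).trans ht)
  have htT : T ≤ t := (le_max_left _ _).trans ((le_max_right _ _).trans ht)
  have htx : Real.exp x₀ ≤ t := (le_max_right _ _).trans ((le_max_right _ _).trans ht)
  have hexp : t * Real.exp w = Real.exp (Real.log t + w) := by
    rw [Real.exp_add, Real.exp_log ht1]
  have hle : t ≤ t * Real.exp w := le_mul_of_one_le_right ht1.le (Real.one_le_exp hw)
  have h1 := hx₀ (Real.log t) ((Real.le_log_iff_exp_le ht1).2 htx) w hw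
  rw [← hexp, Real.exp_log ht1] at h1
  have hp1 : 0 < |A t| := lt_of_le_of_ne (abs_nonneg _) (hT t htT).symm
  have hp2 : 0 < |A (t * Real.exp w)| := lt_of_le_of_ne (abs_nonneg _) (hT _ (htT.trans hle)).symm
  rw [← Real.log_le_log_iff hp2 (by positivity), Real.log_mul (by positivity) hp1.ne', ← Real.exp_add,
    Real.log_exp]
  linarith

/-! ### The quantile function -/

section Quantile

variable (μ : Measure ℝ)

/-- Right continuity of the distribution function means that the infimum defining the quantile is
attained. -/
lemma quantile_cdf_le_iff {p : ℝ} (hp : p ∈ Set.Ioo (0 : ℝ) 1) (x : ℝ) :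
    quantile (fun x => cdf μ x) p ≤ x ↔ p ≤ cdf μ x := by
  set S : Set ℝ := {x | p ≤ cdf μ x} with hS
  have hne : S.Nonempty := by
    obtain ⟨x, hx⟩ := ((tendsto_cdf_atTop μ).eventually (lt_mem_nhds hp.2)).exists
    exact ⟨x, hx.le⟩
  have hbdd : BddBelow S := by
    obtain ⟨b, hb⟩ := ((tendsto_cdf_atBot μ).eventually (gt_mem_nhds hp.1)).exists
    refine ⟨b, fun y hy => ?_⟩
    by_contra! h
    exact absurd (hy.trans (monotone_cdf μ h.le)) (not_le.2 hb)
  constructor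
  · intro h
    refine le_trans ?_ (monotone_cdf μ h)
    have hrc : Tendsto (cdf μ) (𝓝[>] (sInf S)) (𝓝 (cdf μ (sInf S))) :=
      ((cdf μ).right_continuous (sInf S)).tendsto.mono_left
        (nhdsWithin_mono _ Set.Ioi_subset_Ici_self)
    refine ge_of_tendsto hrc ?_
    filter_upwards [self_mem_nhdsWithin] with y hy
    obtain ⟨z, hz, hzy⟩ := exists_lt_of_csInf_lt hne hy
    exact (show p ≤ cdf μ z from hz).trans (monotone_cdf μ hzy.le)
  · intro h
    exact csInf_le hbdd h

lemma monotoneOn_quantile_cdf :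
    MonotoneOn (quantile fun x => cdf μ x) (Set.Ioo 0 1) := by
  intro p hp q hq hpq
  rw [quantile_cdf_le_iff μ hp]
  exact hpq.trans ((quantile_cdf_le_iff μ hq _).1 le_rfl)

/-- Inverse transform sampling: by the Galois connection above, the preimage of (-∞, x] in (0, 1) is
cut out by p ≤ F x. -/
lemma map_quantile_cdf [IsProbabilityMeasure μ] :
    (volume.restrict (Set.Ioo (0 : ℝ) 1)).map (quantile fun x => cdf μ x) = μ := by
  have hm := aemeasurable_restrict_of_monotoneOn (μ := volume) measurableSet_Ioo
    (monotoneOn_quantile_cdf μ)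
  refine Measure.ext_of_Iic _ _ fun x => ?_
  rw [Measure.map_apply_of_aemeasurable hm measurableSet_Iic,
    Measure.restrict_apply' measurableSet_Ioo, ← ofReal_cdf]
  have h1 : (quantile fun x => cdf μ x) ⁻¹' Set.Iic x ∩ Set.Ioo 0 1
      = Set.Iic (cdf μ x) ∩ Set.Ioo 0 1 := by
    ext p
    constructor
    · rintro ⟨h1, h2⟩
      exact ⟨(quantile_cdf_le_iff μ h2 x).1 h1, h2⟩
    · rintro ⟨h1, h2⟩
      exact ⟨(quantile_cdf_le_iff μ h2 x).2 h1, h2⟩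
  rw [h1]
  have hc1 := cdf_le_one μ x
  refine le_antisymm ?_ ?_
  · calc volume (Set.Iic (cdf μ x) ∩ Set.Ioo 0 1) ≤ volume (Set.Ioc 0 (cdf μ x)) :=
          measure_mono fun p hp => ⟨hp.2.1, hp.1⟩
      _ = ENNReal.ofReal (cdf μ x) := by rw [Real.volume_Ioc, sub_zero]
  · calc ENNReal.ofReal (cdf μ x) = volume (Set.Ioo 0 (cdf μ x)) := by
          rw [Real.volume_Ioo, sub_zero]
      _ ≤ volume (Set.Iic (cdf μ x) ∩ Set.Ioo 0 1) :=
          measure_mono fun p hp => ⟨hp.2.le, hp.1, hp.2.trans_le hc1⟩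

lemma measure_eq_volume_quantile_preimage [IsProbabilityMeasure μ] {B : Set ℝ} (hB : MeasurableSet B) :
    μ B = volume ((quantile fun x => cdf μ x) ⁻¹' B ∩ Set.Ioo 0 1) := by
  conv_lhs => rw [← map_quantile_cdf μ]
  rw [Measure.map_apply_of_aemeasurable (aemeasurable_restrict_of_monotoneOn measurableSet_Ioo
    (monotoneOn_quantile_cdf μ)) hB, Measure.restrict_apply' measurableSet_Ioo]

/-- Above a level `p` at which the quantile function increases strictly, the law of the
observations is the image of Lebesgue measure on `(p, 1)`. -/
lemma measure_inter_Ioi_quantile [IsProbabilityMeasure μ] {p : ℝ} (hp : p ∈ Set.Ioo (0 : ℝ) 1)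
    (hQ : StrictMonoOn (quantile fun x => cdf μ x) (Set.Ico p 1)) {B : Set ℝ}
    (hB : MeasurableSet B) :
    μ (Set.Ioi (quantile (fun x => cdf μ x) p) ∩ B)
      = volume ((quantile fun x => cdf μ x) ⁻¹' B ∩ Set.Ioo p 1) := by
  rw [measure_eq_volume_quantile_preimage μ (measurableSet_Ioi.inter hB)]
  congr 1
  ext q
  constructor
  · rintro ⟨⟨h1, h2⟩, h3⟩
    refine ⟨h2, ?_, h3.2⟩
    by_contra! h
    exact absurd (monotoneOn_quantile_cdf μ h3 hp h) (not_le.2 h1)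
  · rintro ⟨h1, h2⟩
    exact ⟨⟨hQ ⟨le_rfl, hp.2⟩ ⟨h2.1.le, h2.2⟩ h2.1, h1⟩, hp.1.trans h2.1, h2.2⟩

end Quantile

/-! ### The tail quantile function in exponential scale -/

/-- The tail quantile function `x ↦ Q (1 - exp (-x))`. -/
noncomputable def tailQuantile (Q : ℝ → ℝ) (x : ℝ) : ℝ := Q (1 - Real.exp (-x))

/-- The derivative of the tail quantile function. -/
noncomputable def tailSlope (Q : ℝ → ℝ) (x : ℝ) : ℝ :=
  deriv Q (1 - Real.exp (-x)) * Real.exp (-x)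

lemma hasDerivAt_one_sub_exp_neg (x : ℝ) :
    HasDerivAt (fun x : ℝ => 1 - Real.exp (-x)) (Real.exp (-x)) x := by
  have := ((hasDerivAt_neg x).exp).const_sub 1
  simpa using this

/-- No regularity of Q is needed, since the derivative of any real function is measurable. The
Potter bounds depend on this measurability. -/
lemma measurable_vonMisesRate (Q : ℝ → ℝ) (γ : ℝ) : Measurable (vonMisesRate Q γ) := by
  have h1 : Measurable fun t : ℝ => 1 - 1 / t := measurable_const.sub (measurable_const.div measurable_id)
  have h2 : Measurable fun t : ℝ => deriv Q (1 - 1 / t) := (measurable_deriv Q).comp h1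
  have h3 : Measurable fun t : ℝ => deriv (deriv Q) (1 - 1 / t) := (measurable_deriv _).comp h1
  unfold vonMisesRate
  exact ((((h3.div measurable_id).sub (h2.const_mul 2)).div h2).add_const 1).sub_const γ

lemma tendsto_one_sub_exp_neg : Tendsto (fun x : ℝ => 1 - Real.exp (-x)) atTop (𝓝[<] 1) := by
  refine tendsto_nhdsWithin_iff.2 ⟨?_, Eventually.of_forall fun x => by
    simpa using Real.exp_pos _⟩
  have : Tendsto (fun x : ℝ => 1 - Real.exp (-x)) atTop (𝓝 (1 - 0)) :=
    (Real.tendsto_exp_neg_atTop_nhds_zero).const_sub 1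
  simpa using this

/-- Near the right end-point the tail quantile function is differentiable with positive
derivative, and the logarithmic derivative of the latter is `γ + A`. -/
lemma VonMisesSecondOrder.exists_hasDerivAt {μ : Measure ℝ} [IsProbabilityMeasure μ]
    {Q a : ℝ → ℝ} {γ ρ : ℝ} (hQ : Q = quantile fun x => cdf μ x)
    (h : VonMisesSecondOrder (fun x => cdf μ x) a γ ρ) :
    ∃ x₁ : ℝ, 0 < x₁ ∧ ∀ x, x₁ ≤ x →
      HasDerivAt Q (deriv Q (1 - Real.exp (-x))) (1 - Real.exp (-x)) ∧
      HasDerivAt (tailQuantile Q) (tailSlope Q x) x ∧ 0 < tailSlope Q x ∧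
      HasDerivAt (fun x => Real.log (tailSlope Q x)) (γ + vonMisesRate Q γ (Real.exp x)) x := by
  obtain ⟨-, h2, h3⟩ := h
  obtain ⟨-, hA0, -, hRV, -⟩ := h3
  rw [← hQ] at h2 hA0 hRV
  -- These two facts exclude zeros of Q'. At such a zero, division by zero gives A = 1 - γ; this
  -- contradicts A → 0 if γ ≠ 1, and A ≠ 0 if γ = 1.
  have hne : ∀ᶠ x in atTop, vonMisesRate Q γ (Real.exp x) ≠ 0 := by
    filter_upwards [Real.tendsto_exp_atTop.eventually hRV.eventually_ne] with x hx
    simpa using hx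
  have hsmall : ∀ᶠ x in atTop, γ = 1 ∨ vonMisesRate Q γ (Real.exp x) ≠ 1 - γ := by
    by_cases hγ : γ = 1
    · exact Eventually.of_forall fun _ => Or.inl hγ
    · have : (0 : ℝ) ≠ 1 - γ := fun h => hγ (by linarith)
      filter_upwards [(hA0.comp Real.tendsto_exp_atTop).eventually_ne this] with x hx
      exact Or.inr hx
  obtain ⟨x₁, hx₁⟩ := eventually_atTop.1
    ((eventually_gt_atTop (0 : ℝ)).and ((tendsto_one_sub_exp_neg.eventually h2).and
      (hne.and hsmall)))
  refine ⟨x₁, (hx₁ x₁ le_rfl).1, fun x hx => ?_⟩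
  obtain ⟨hx0, ⟨hd1, hd2⟩, hxne, hxs⟩ := hx₁ x hx
  have he : 1 / Real.exp x = Real.exp (-x) := by rw [Real.exp_neg, one_div]
  have hQd : HasDerivAt Q (deriv Q (1 - Real.exp (-x))) (1 - Real.exp (-x)) :=
    hd1.self_of_nhds.hasDerivAt
  have hp : 1 - Real.exp (-x) ∈ Set.Ioo (0 : ℝ) 1 := by
    have : Real.exp (-x) < 1 := by simpa using hx0
    have := Real.exp_pos (-x)
    constructor <;> linarith
  have hQ'0 : deriv Q (1 - Real.exp (-x)) ≠ 0 := by
    intro h0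
    have hA : vonMisesRate Q γ (Real.exp x) = 1 - γ := by
      unfold vonMisesRate
      rw [he, h0]
      simp
    rcases hxs with h1 | h1
    · exact hxne (by rw [hA, h1]; ring)
    · exact h1 hA
  have hQ'nn : 0 ≤ deriv Q (1 - Real.exp (-x)) := by
    have hmono : MonotoneOn Q (Set.Ioo 0 1) := hQ ▸ monotoneOn_quantile_cdf μ
    have h4 := hmono.derivWithin_nonneg (x := 1 - Real.exp (-x))
    rwa [derivWithin_of_isOpen isOpen_Ioo hp] at h4
  have hQ'pos : 0 < deriv Q (1 - Real.exp (-x)) := lt_of_le_of_ne hQ'nn hQ'0.symm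
  have hpos : 0 < tailSlope Q x := mul_pos hQ'pos (Real.exp_pos _)
  refine ⟨hQd, HasDerivAt.comp x (h₂ := Q) hQd (hasDerivAt_one_sub_exp_neg x), hpos, ?_⟩
  have h5 : HasDerivAt (fun x => deriv Q (1 - Real.exp (-x)))
      (deriv (deriv Q) (1 - Real.exp (-x)) * Real.exp (-x)) x :=
    HasDerivAt.comp x (h₂ := deriv Q) hd2.hasDerivAt (hasDerivAt_one_sub_exp_neg x)
  have h6 : HasDerivAt (fun x : ℝ => Real.exp (-x)) (-Real.exp (-x)) x := by
    simpa using (hasDerivAt_neg x).exp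
  have h7 := (h5.mul h6).log hpos.ne'
  have h8 : vonMisesRate Q γ (Real.exp x) = (deriv (deriv Q) (1 - Real.exp (-x)) * Real.exp (-x)
      - 2 * deriv Q (1 - Real.exp (-x))) / deriv Q (1 - Real.exp (-x)) + 1 - γ := by
    unfold vonMisesRate
    rw [he, div_eq_mul_inv _ (Real.exp x), ← Real.exp_neg]
  rw [h8]
  refine h7.congr_deriv ?_
  rw [Pi.mul_apply]
  have := Real.exp_pos (-x)
  field_simp
  ring

/-! ### Comparison of the tail quantile function with a Box-Cox curve -/

/-- A function whose derivative is dominated by that of `B` is dominated by `B`. -/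
lemma abs_le_of_hasDerivAt_le {D D' B B' : ℝ → ℝ} {V : ℝ}
    (hD : ∀ v ∈ Set.Icc 0 V, HasDerivAt D (D' v) v) (hB : ∀ v, HasDerivAt B (B' v) v)
    (h0 : |D 0| ≤ B 0) (h : ∀ v ∈ Set.Icc 0 V, |D' v| ≤ B' v) :
    ∀ v ∈ Set.Icc 0 V, |D v| ≤ B v := by
  intro v hv
  have := image_norm_le_of_norm_deriv_right_le_deriv_boundary (f := D) (f' := D') (a := 0) (b := V)
    (fun x hx => (hD x hx).continuousAt.continuousWithinAt)
    (fun x hx => (hD x ⟨hx.1, hx.2.le⟩).hasDerivWithinAt) h0 hB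
    (fun x hx => h x ⟨hx.1, hx.2.le⟩) hv
  simpa using this

/-- Used with f the logarithm of the slope and B the rate function A: small A makes the slope nearly
proportional to e^{γv}. -/
lemma abs_sub_sub_mul_le {f : ℝ → ℝ} {B : ℝ → ℝ} {γ Δ V : ℝ}
    (hf : ∀ v ∈ Set.Icc 0 V, HasDerivAt f (γ + B v) v) (hB : ∀ v ∈ Set.Icc 0 V, |B v| ≤ Δ) :
    ∀ v ∈ Set.Icc 0 V, |f v - f 0 - γ * v| ≤ Δ * v := by
  refine abs_le_of_hasDerivAt_le (D' := B) (B := fun v => Δ * v) (B' := fun _ => Δ)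
    (fun v hv => ?_) (fun v => ?_) (by simp) hB
  · have := ((hf v hv).sub_const (f 0)).sub ((hasDerivAt_id' v).const_mul γ)
    refine this.congr_deriv ?_
    ring
  · simpa using (hasDerivAt_id' v).const_mul Δ

lemma abs_exp_sub_one_le_two_mul {x : ℝ} (hx : |x| ≤ 1) : |Real.exp x - 1| ≤ 2 * |x| :=
  Real.abs_exp_sub_one_le hx

/-- The weight of the location error at the log-ratio `V`. -/
noncomputable def locationWeight (γ V : ℝ) : ℝ :=
  if 0 < γ then 1 + V else if γ = 0 then (1 + V) ^ 2 else (1 + V) + Real.exp (-γ * V)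

lemma one_add_le_locationWeight {γ V : ℝ} (hV : 0 ≤ V) : 1 + V ≤ locationWeight γ V := by
  unfold locationWeight
  split_ifs
  · exact le_rfl
  · nlinarith
  · linarith [Real.exp_pos (-γ * V)]

/-- `D` measures the distance of a curve from the Box-Cox curve `boxCox c`; small errors in the
logarithmic derivative and in the parameters lead to small relative errors. -/
lemma exists_abs_le_exp_mul_locationWeight (γ : ℝ) :
    ∃ c₀ C₀ : ℝ, 0 < c₀ ∧ 0 < C₀ ∧ ∀ (c Δ V : ℝ) (D ψ : ℝ → ℝ), 0 ≤ Δ → 0 ≤ V →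
      Δ * locationWeight γ V ≤ c₀ → |c - γ| ≤ Δ → |D 0| ≤ Δ →
      (∀ v ∈ Set.Icc 0 V, HasDerivAt D (ψ v * Real.exp (c * v)) v) →
      (∀ v ∈ Set.Icc 0 V, |ψ v| ≤ 2 * (Δ * (1 + 2 * v))) →
      ∀ v ∈ Set.Icc 0 V, |D v| ≤ Real.exp (c * v) * (C₀ * (Δ * locationWeight γ V)) := by
  rcases lt_trichotomy γ 0 with hγ | hγ | hγ
  -- For γ < 0 the exponent satisfies c ≤ -κ, so (1 + 2v) e^{cv} is integrable and D stays O(Δ);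
  -- half of the decay rate κ absorbs the linear factor. Writing the bound relative to e^{cv} costs
  -- e^{-γV}, up to a factor e.
  · set κ : ℝ := -γ / 2 with hκ
    have hκ0 : 0 < κ := by rw [hκ]; linarith
    refine ⟨min 1 κ, (1 + 4 * (1 + 4 / κ) / κ) * Real.exp 1, by positivity, by positivity, ?_⟩
    intro c Δ V D ψ hΔ hV hΔW hc hD0 hD hψ v hv
    have hW := one_add_le_locationWeight (γ := γ) hV
    have hΔV : Δ * (1 + V) ≤ min 1 κ := (mul_le_mul_of_nonneg_left hW hΔ).trans hΔW
    have hΔ1 : Δ * V ≤ 1 := by nlinarith [min_le_left 1 κ]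
    have hΔκ : Δ ≤ κ := by nlinarith [min_le_right 1 κ]
    have hcκ : c ≤ -κ := by have := (abs_le.1 hc).2; rw [hκ] at hΔκ ⊢; linarith
    have hmain := abs_le_of_hasDerivAt_le (D := D) (V := V)
      (B := fun v => Δ + 4 * Δ * (1 + 4 / κ) / κ * (1 - Real.exp (-(κ / 2) * v)))
      (B' := fun v => 4 * Δ * (1 + 4 / κ) / κ * (κ / 2 * Real.exp (-(κ / 2) * v))) hD
      (fun v => by
        have := (((((hasDerivAt_id' v).const_mul (-(κ / 2))).exp.const_sub 1).const_mul
          (4 * Δ * (1 + 4 / κ) / κ)).const_add Δ)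
        refine this.congr_deriv ?_
        ring)
      (by simpa using hD0)
      (fun v hv => by
        rw [abs_mul, abs_of_pos (Real.exp_pos _)]
        have h1 : 1 + 2 * v ≤ (1 + 4 / κ) * Real.exp (κ / 2 * v) := by
          have h2 : 0 ≤ κ / 2 * v := mul_nonneg (by positivity) hv.1
          have h3 := Real.add_one_le_exp (κ / 2 * v)
          have h4 : 2 * v = 4 / κ * (κ / 2 * v) := by field_simp; ring
          have h5 : 0 < 4 / κ := by positivity
          nlinarith
        have h2 : Real.exp (c * v) ≤ Real.exp (-κ * v) :=
          Real.exp_le_exp.2 (mul_le_mul_of_nonneg_right hcκ hv.1)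
        calc |ψ v| * Real.exp (c * v)
            ≤ 2 * (Δ * ((1 + 4 / κ) * Real.exp (κ / 2 * v))) * Real.exp (-κ * v) := by
              refine mul_le_mul ((hψ v hv).trans ?_) h2 (Real.exp_pos _).le (by positivity)
              gcongr
          _ = 2 * Δ * (1 + 4 / κ) * (Real.exp (κ / 2 * v) * Real.exp (-κ * v)) := by ring
          _ = 2 * Δ * (1 + 4 / κ) * Real.exp (-(κ / 2) * v) := by
              rw [← Real.exp_add]; ring_nf
          _ = 4 * Δ * (1 + 4 / κ) / κ * (κ / 2 * Real.exp (-(κ / 2) * v)) := by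
              field_simp; ring) v hv
    have h1 : |D v| ≤ (1 + 4 * (1 + 4 / κ) / κ) * Δ := by
      refine hmain.trans ?_
      have : 0 ≤ 4 * Δ * (1 + 4 / κ) / κ * Real.exp (-(κ / 2) * v) := by positivity
      have h2 : 4 * Δ * (1 + 4 / κ) / κ = 4 * (1 + 4 / κ) / κ * Δ := by ring
      nlinarith
    have h2 : 1 ≤ Real.exp (c * v) * (Real.exp 1 * Real.exp (-γ * V)) := by
      rw [← Real.exp_add, ← Real.exp_add]
      refine Real.one_le_exp ?_
      have h3 : γ - Δ ≤ c := by linarith [(abs_le.1 hc).1]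
      have h4 : (γ - Δ) * v ≤ c * v := mul_le_mul_of_nonneg_right h3 hv.1
      have h5 : Δ * v ≤ Δ * V := mul_le_mul_of_nonneg_left hv.2 hΔ
      have h6 : γ * V ≤ γ * v := mul_le_mul_of_nonpos_left hv.2 hγ.le
      linarith
    have hW2 : Real.exp (-γ * V) ≤ locationWeight γ V := by
      rw [locationWeight, if_neg hγ.le.not_gt, if_neg hγ.ne]
      linarith
    calc |D v| ≤ (1 + 4 * (1 + 4 / κ) / κ) * Δ * 1 := by rw [mul_one]; exact h1
      _ ≤ (1 + 4 * (1 + 4 / κ) / κ) * Δ * (Real.exp (c * v) * (Real.exp 1 * Real.exp (-γ * V))) := by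
          gcongr
      _ ≤ (1 + 4 * (1 + 4 / κ) / κ) * Δ *
            (Real.exp (c * v) * (Real.exp 1 * locationWeight γ V)) := by
          gcongr
      _ = _ := by ring
  -- For γ = 0 the exponential e^{cv} stays between e^{-1} and e because |cv| ≤ ΔV ≤ 1. Integrating
  -- 1 + 2v produces the square in the weight.
  · subst hγ
    refine ⟨1, Real.exp 1 * (1 + 4 * Real.exp 1), by positivity, by positivity, ?_⟩
    intro c Δ V D ψ hΔ hV hΔW hc hD0 hD hψ v hv
    have hWdef : locationWeight 0 V = (1 + V) ^ 2 := by simp [locationWeight]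
    have hΔV : Δ * (1 + V) ≤ 1 :=
      (mul_le_mul_of_nonneg_left (one_add_le_locationWeight (γ := 0) hV) hΔ).trans hΔW
    have hΔ1 : Δ * V ≤ 1 := by nlinarith
    rw [sub_zero] at hc
    have hcv : ∀ v ∈ Set.Icc 0 V, |c * v| ≤ 1 := fun v hv => by
      rw [abs_mul, abs_of_nonneg hv.1]
      exact (mul_le_mul hc hv.2 hv.1 hΔ).trans hΔ1
    have hmain := abs_le_of_hasDerivAt_le (D := D) (V := V)
      (B := fun v => Δ + 2 * (Δ * (1 + 2 * V)) * Real.exp 1 * v)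
      (B' := fun v => 2 * (Δ * (1 + 2 * V)) * Real.exp 1) hD
      (fun v => by simpa using ((hasDerivAt_id' v).const_mul _).const_add Δ)
      (by simpa using hD0)
      (fun v hv => by
        rw [abs_mul, abs_of_pos (Real.exp_pos _)]
        have h1 : Real.exp (c * v) ≤ Real.exp 1 := Real.exp_le_exp.2 (abs_le.1 (hcv v hv)).2
        refine mul_le_mul ((hψ v hv).trans ?_) h1 (Real.exp_pos _).le (by positivity)
        have := hv.2
        gcongr) v hv
    have h1 : |D v| ≤ (1 + 4 * Real.exp 1) * (Δ * (1 + V) ^ 2) := by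
      refine hmain.trans ?_
      have h3 : 2 * (Δ * (1 + 2 * V)) * Real.exp 1 * v ≤ 2 * (Δ * (1 + 2 * V)) * Real.exp 1 * V :=
        mul_le_mul_of_nonneg_left hv.2 (by positivity)
      have h4 : (1 + 2 * V) * V ≤ 2 * (1 + V) ^ 2 := by nlinarith
      have h5 : Δ ≤ Δ * (1 + V) ^ 2 := le_mul_of_one_le_right hΔ (by nlinarith)
      have h6 : 2 * Δ * Real.exp 1 * ((1 + 2 * V) * V) ≤ 2 * Δ * Real.exp 1 * (2 * (1 + V) ^ 2) := by
        gcongr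
      linarith
    have h2 : 1 ≤ Real.exp (c * v) * Real.exp 1 := by
      rw [← Real.exp_add]
      exact Real.one_le_exp (by linarith [(abs_le.1 (hcv v hv)).1])
    rw [hWdef]
    calc |D v| ≤ (1 + 4 * Real.exp 1) * (Δ * (1 + V) ^ 2) * 1 := by rw [mul_one]; exact h1
      _ ≤ (1 + 4 * Real.exp 1) * (Δ * (1 + V) ^ 2) * (Real.exp (c * v) * Real.exp 1) := by gcongr
      _ = _ := by ring
  -- For γ > 0 the integral of e^{cv} is at most (2/γ) e^{cv}, since c ≥ γ/2, so only the linear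
  -- factor 1 + V survives.
  · refine ⟨γ / 2, 1 + 8 / γ, by positivity, by positivity, ?_⟩
    intro c Δ V D ψ hΔ hV hΔW hc hD0 hD hψ v hv
    have hWdef : locationWeight γ V = 1 + V := by simp [locationWeight, hγ]
    rw [hWdef] at hΔW ⊢
    have hΔ2 : Δ ≤ γ / 2 := by nlinarith
    have hcγ : γ / 2 ≤ c := by linarith [(abs_le.1 hc).1]
    have hc0 : 0 < c := by linarith
    have hmain := abs_le_of_hasDerivAt_le (D := D) (V := V)
      (B := fun v => Δ + 2 * (Δ * (1 + 2 * V)) * boxCox c v)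
      (B' := fun v => 2 * (Δ * (1 + 2 * V)) * Real.exp (c * v)) hD
      (fun v => ((hasDerivAt_boxCox c v).const_mul _).const_add Δ)
      (by simpa [boxCox_zero] using hD0)
      (fun v hv => by
        rw [abs_mul, abs_of_pos (Real.exp_pos _)]
        refine mul_le_mul_of_nonneg_right ((hψ v hv).trans ?_) (Real.exp_pos _).le
        have := hv.2
        gcongr) v hv
    refine hmain.trans ?_
    have he : 1 ≤ Real.exp (c * v) := Real.one_le_exp (mul_nonneg hc0.le hv.1)
    have hb : boxCox c v ≤ 2 / γ * Real.exp (c * v) := by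
      rw [boxCox, if_neg hc0.ne', div_le_iff₀ hc0]
      have : 1 ≤ 2 / γ * c := by
        rw [div_mul_eq_mul_div, le_div_iff₀ hγ]; linarith
      nlinarith
    calc Δ + 2 * (Δ * (1 + 2 * V)) * boxCox c v
        ≤ Δ * (1 + V) * Real.exp (c * v)
          + 2 * (Δ * (2 * (1 + V))) * (2 / γ * Real.exp (c * v)) := by
          refine add_le_add ?_ ?_
          · calc Δ = Δ * 1 * 1 := by ring
              _ ≤ Δ * (1 + V) * Real.exp (c * v) := by gcongr; linarith
          · refine mul_le_mul ?_ hb ?_ (by positivity)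
            · gcongr; linarith
            · rw [← boxCox_zero c]; exact (boxCox_strictMono c).monotone hv.1
      _ = _ := by ring

/-- Along a curve close to the Box-Cox curve, the predictive density is bounded below by the
density of the exponential law, up to a small relative error. -/
lemma exists_le_predictiveDensity_mul (γ : ℝ) :
    ∃ c₀ C₀ : ℝ, 0 < c₀ ∧ 0 < C₀ ∧ ∀ (c Δ V σ u τ : ℝ) (q d : ℝ → ℝ), 0 ≤ Δ → 0 ≤ V →
      Δ * locationWeight γ V ≤ c₀ → |c - γ| ≤ Δ → 0 < σ → 0 < τ → |q 0 - u| ≤ Δ * σ →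
      (∀ v ∈ Set.Icc 0 V, HasDerivAt q (d v) v) → (∀ v ∈ Set.Icc 0 V, 0 < d v) →
      (∀ v ∈ Set.Icc 0 V, |Real.log (d v) - Real.log σ - γ * v| ≤ Δ * (1 + v)) →
      ∀ v ∈ Set.Icc 0 V, -Real.log τ + C₀ * (Δ * locationWeight γ V) < v →
        (1 - C₀ * (Δ * locationWeight γ V)) * Real.exp (-Real.log τ - v)
          ≤ predictiveDensity c σ u τ (q v) * d v := by
  obtain ⟨c₁, C₁, hc₁, hC₁, hmain⟩ := exists_abs_le_exp_mul_locationWeight γ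
  -- The bound 1/2 keeps the error of the log-slope at most 1, and the last one allows the local
  -- inversion of `boxCox c`. In C₀ the first term bounds (1 + c) y and the summand 2 the error of
  -- the log-slope.
  refine ⟨min c₁ (min (1 / 2) (1 / (2 * (|γ| + 1) * C₁))), 2 * C₁ * (|γ| + 2) + 2,
    by positivity, by positivity, ?_⟩
  intro c Δ V σ u τ q d hΔ hV hΔW hc hσ hτ hu hq hd hlog v hv hvL
  set W := locationWeight γ V with hWdef
  have hW : 1 + V ≤ W := one_add_le_locationWeight hV
  have hΔW1 : Δ * W ≤ c₁ := hΔW.trans (min_le_left _ _)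
  have hΔW2 : Δ * W ≤ 1 / 2 := hΔW.trans ((min_le_right _ _).trans (min_le_left _ _))
  have hΔW3 : (|γ| + 1) * (C₁ * (Δ * W)) ≤ 1 / 2 := by
    have h := hΔW.trans ((min_le_right _ _).trans (min_le_right _ _))
    rw [le_div_iff₀ (by positivity)] at h
    linarith
  have hΔW0 : 0 ≤ Δ * W := mul_nonneg hΔ (by linarith)
  have hΔ1 : Δ ≤ Δ * W := le_mul_of_one_le_right hΔ (by linarith)
  have hcabs : |c| ≤ |γ| + 1 := by
    have := abs_add_le (c - γ) γ
    rw [sub_add_cancel] at this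
    linarith
  have hψlog : ∀ w ∈ Set.Icc 0 V, |Real.log (d w) - Real.log σ - c * w| ≤ Δ * (1 + 2 * w) := by
    intro w hw
    have h1 := hlog w hw
    have h2 : |(γ - c) * w| ≤ Δ * w := by
      rw [abs_mul, abs_of_nonneg hw.1, abs_sub_comm]
      exact mul_le_mul_of_nonneg_right hc hw.1
    calc |Real.log (d w) - Real.log σ - c * w|
        = |(Real.log (d w) - Real.log σ - γ * w) + (γ - c) * w| := by ring_nf
      _ ≤ _ := (abs_add_le _ _).trans (by linarith)
  have hψle : ∀ w ∈ Set.Icc 0 V, Δ * (1 + 2 * w) ≤ 2 * (Δ * W) := by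
    intro w hw
    nlinarith [hw.2, mul_le_mul_of_nonneg_left (show 1 + 2 * w ≤ 2 * W by linarith [hw.2]) hΔ]
  have hdexp : ∀ w ∈ Set.Icc 0 V,
      d w / σ = Real.exp (Real.log (d w) - Real.log σ - c * w) * Real.exp (c * w) := by
    intro w hw
    rw [← Real.exp_add, sub_add_cancel, Real.exp_sub, Real.exp_log (hd w hw), Real.exp_log hσ]
  have hD := hmain c Δ V (fun w => (q w - u) / σ - boxCox c w)
    (fun w => Real.exp (Real.log (d w) - Real.log σ - c * w) - 1) hΔ hV hΔW1 hc
    (by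
      rw [boxCox_zero, sub_zero, abs_div, abs_of_pos hσ, div_le_iff₀ hσ]
      exact hu)
    (fun w hw => by
      refine ((((hq w hw).sub_const u).div_const σ).sub (hasDerivAt_boxCox c w)).congr_deriv ?_
      rw [hdexp w hw]
      ring)
    (fun w hw => by
      have h1 := hψlog w hw
      refine (abs_exp_sub_one_le_two_mul ?_).trans ?_
      · linarith [hψle w hw]
      · linarith) v hv
  set D := (q v - u) / σ - boxCox c v with hDdef
  have hD' : |Real.exp (-(c * v)) * D| ≤ C₁ * (Δ * W) := by
    rw [abs_mul, abs_of_pos (Real.exp_pos _)]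
    calc Real.exp (-(c * v)) * |D|
        ≤ Real.exp (-(c * v)) * (Real.exp (c * v) * (C₁ * (Δ * W))) := by gcongr
      _ = C₁ * (Δ * W) := by rw [← mul_assoc, ← Real.exp_add]; simp
  -- The location error D, measured relative to the Box-Cox slope e^{cv}, is turned by `boxCox_add`
  -- into a small shift y of the argument v.
  obtain ⟨y, hy, hyabs⟩ := exists_boxCox_eq_abs_le (c := c) (d := Real.exp (-(c * v)) * D) (by
    rw [abs_mul]
    refine (mul_le_mul hcabs hD' (abs_nonneg _) (by positivity)).trans hΔW3)
  have hyle : |y| ≤ 2 * C₁ * (Δ * W) := by linarith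
  have hqv : q v = u + σ * boxCox c (v + y) := by
    rw [boxCox_add, hy, ← mul_assoc, ← Real.exp_add, add_neg_cancel, Real.exp_zero, one_mul, hDdef]
    field_simp
    ring
  have hC : 2 * C₁ * (Δ * W) ≤ (2 * C₁ * (|γ| + 2) + 2) * (Δ * W) := by
    refine mul_le_mul_of_nonneg_right ?_ hΔW0
    nlinarith [abs_nonneg γ]
  have hℓ : -Real.log τ < v + y := by
    have := (abs_le.1 hyle).1
    linarith
  rw [hqv, predictiveDensity_boxCox c u hσ hτ hℓ]
  have hrw : Real.exp (-Real.log τ - (1 + c) * (v + y)) / σ * d v = Real.exp (-Real.log τ - v)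
      * Real.exp (-(1 + c) * y + (Real.log (d v) - Real.log σ - c * v)) := by
    rw [div_mul_eq_mul_div, mul_div_assoc, hdexp v hv, ← Real.exp_add, ← Real.exp_add,
      ← Real.exp_add]
    ring_nf
  rw [hrw, mul_comm]
  refine mul_le_mul_of_nonneg_left ?_ (Real.exp_pos _).le
  have h1 : |(1 + c) * y| ≤ (|γ| + 2) * (2 * C₁ * (Δ * W)) := by
    rw [abs_mul]
    refine mul_le_mul ?_ hyle (abs_nonneg _) (by positivity)
    refine (abs_add_le 1 c).trans ?_
    rw [abs_one]
    linarith
  have h2 := (abs_le.1 ((hψlog v hv).trans (hψle v hv))).1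
  have h3 := (abs_le.1 h1).2
  have h4 := Real.add_one_le_exp (-(1 + c) * y + (Real.log (d v) - Real.log σ - c * v))
  linarith

/-! ### Transport of a density along the quantile function -/

/-- Substituting y = Q p turns a lower bound for the density pulled back to levels into a comparison
of measures on arbitrary Borel sets. -/
lemma mul_volume_le_lintegral {Q Q' : ℝ → ℝ} {p₁ p₂ : ℝ} {f : ℝ → ENNReal} {c : ENNReal}
    (hQ : ∀ p ∈ Set.Ioo p₁ p₂, HasDerivAt Q (Q' p) p) (hpos : ∀ p ∈ Set.Ioo p₁ p₂, 0 < Q' p)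
    (hc : ∀ p ∈ Set.Ioo p₁ p₂, c ≤ ENNReal.ofReal (Q' p) * f (Q p)) {B : Set ℝ}
    (hB : MeasurableSet B) :
    c * volume (Q ⁻¹' B ∩ Set.Ioo p₁ p₂) ≤ ∫⁻ y in B, f y := by
  have hcont : ContinuousOn Q (Set.Ioo p₁ p₂) := fun p hp =>
    (hQ p hp).continuousAt.continuousWithinAt
  have hmono : StrictMonoOn Q (Set.Ioo p₁ p₂) := by
    refine strictMonoOn_of_deriv_pos (convex_Ioo _ _) hcont fun p hp => ?_
    rw [interior_Ioo] at hp
    rw [(hQ p hp).deriv]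
    exact hpos p hp
  have hms : MeasurableSet (Q ⁻¹' B ∩ Set.Ioo p₁ p₂) := by
    have h1 : MeasurableSet ((Set.Ioo p₁ p₂).domRestrict Q ⁻¹' B) :=
      (continuousOn_iff_continuous_domRestrict.1 hcont).measurable hB
    have h2 := measurableSet_Ioo.subtype_image h1
    convert h2 using 1
    ext p
    simp [and_comm, Set.domRestrict]
  calc c * volume (Q ⁻¹' B ∩ Set.Ioo p₁ p₂)
      = ∫⁻ _ in Q ⁻¹' B ∩ Set.Ioo p₁ p₂, c := by rw [setLIntegral_const]
    _ ≤ ∫⁻ p in Q ⁻¹' B ∩ Set.Ioo p₁ p₂, ENNReal.ofReal |Q' p| * f (Q p) := by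
        refine setLIntegral_mono' hms fun p hp => ?_
        rw [abs_of_pos (hpos p hp.2)]
        exact hc p hp.2
    _ = ∫⁻ y in Q '' (Q ⁻¹' B ∩ Set.Ioo p₁ p₂), f y :=
        (lintegral_image_eq_lintegral_abs_deriv_mul hms
          (fun p hp => (hQ p hp.2).hasDerivWithinAt)
          (hmono.injOn.mono Set.inter_subset_right) f).symm
    _ ≤ ∫⁻ y in B, f y := by
        refine lintegral_mono_set ?_
        rintro _ ⟨p, hp, rfl⟩
        exact hp.1

lemma volume_inter_Ioo_le (S : Set ℝ) (p₀ p₁ p₂ : ℝ) :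
    volume (S ∩ Set.Ioo p₀ 1) ≤ ENNReal.ofReal (p₁ - p₀) + ENNReal.ofReal (1 - p₂)
      + volume (S ∩ Set.Ioo p₁ p₂) := by
  have hsub : S ∩ Set.Ioo p₀ 1 ⊆ Set.Ioc p₀ p₁ ∪ Set.Ico p₂ 1 ∪ (S ∩ Set.Ioo p₁ p₂) := by
    rintro p ⟨hS, h1, h2⟩
    by_cases h3 : p ≤ p₁
    · exact Or.inl (Or.inl ⟨h1, h3⟩)
    · by_cases h4 : p₂ ≤ p
      · exact Or.inl (Or.inr ⟨h4, h2⟩)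
      · exact Or.inr ⟨hS, not_le.1 h3, not_le.1 h4⟩
  refine (measure_mono hsub).trans ((measure_union_le _ _).trans ?_)
  refine add_le_add ((measure_union_le _ _).trans ?_) le_rfl
  rw [Real.volume_Ioc, Real.volume_Ico]

/-- If, on most of the tail above level `1 - π`, a density `f` of total mass one dominates the
conditional law of the observations up to a factor `1 - θ`, then the two laws almost agree. -/
lemma abs_cond_sub_setIntegral_le {μ : Measure ℝ} [IsProbabilityMeasure μ] {Q Q' f : ℝ → ℝ}
    (hQF : Q = quantile fun x => cdf μ x) {π θ η : ℝ} (hπ : 0 < π) (hπ1 : π < 1) (hθ : 0 ≤ θ)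
    (hθ1 : θ ≤ 1 / 2) (hη : 0 ≤ η)
    (hmono : StrictMonoOn Q (Set.Ico (1 - π) 1))
    (hQ : ∀ p ∈ Set.Ioo (1 - π * Real.exp (-θ)) (1 - π * η), HasDerivAt Q (Q' p) p)
    (hpos : ∀ p ∈ Set.Ioo (1 - π * Real.exp (-θ)) (1 - π * η), 0 < Q' p)
    (hf : ∀ y, 0 ≤ f y) (hf1 : ∫⁻ y, ENNReal.ofReal (f y) = 1)
    (hle : ∀ p ∈ Set.Ioo (1 - π * Real.exp (-θ)) (1 - π * η), (1 - θ) / π ≤ f (Q p) * Q' p)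
    {B : Set ℝ} (hB : MeasurableSet B) (hint : IntegrableOn f B) :
    |(μ[|Set.Ioi (Q (1 - π))]).real B - ∫ y in B, f y| ≤ 3 * θ + η := by
  have hp : (1 - π) ∈ Set.Ioo (0 : ℝ) 1 := ⟨by linarith, by linarith⟩
  have hlaw : ∀ B : Set ℝ, MeasurableSet B →
      μ (Set.Ioi (Q (1 - π)) ∩ B) = volume (Q ⁻¹' B ∩ Set.Ioo (1 - π) 1) := by
    subst hQF
    exact fun B hB => measure_inter_Ioi_quantile μ hp hmono hB
  have htail : μ (Set.Ioi (Q (1 - π))) = ENNReal.ofReal π := by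
    have := hlaw Set.univ MeasurableSet.univ
    rw [Set.inter_univ, Set.preimage_univ, Set.univ_inter, Real.volume_Ioo] at this
    rw [this]
    congr 1
    ring
  have hπ0 : ENNReal.ofReal π ≠ 0 := by simpa using hπ
  set G := μ[|Set.Ioi (Q (1 - π))] with hG
  have : IsProbabilityMeasure G := cond_isProbabilityMeasure (by rw [htail]; exact hπ0)
  have hupper : ∀ B : Set ℝ, MeasurableSet B →
      G.real B ≤ 3 * θ + η + (∫⁻ y in B, ENNReal.ofReal (f y)).toReal := by
    intro B hB
    set H := (∫⁻ y in B, ENNReal.ofReal (f y)) with hH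
    have hH1 : H ≤ 1 := hf1 ▸ setLIntegral_le_lintegral B _
    have hHtop : H ≠ ⊤ := ne_top_of_le_ne_top ENNReal.one_ne_top hH1
    have h1 := mul_volume_le_lintegral (f := fun y => ENNReal.ofReal (f y))
      (c := ENNReal.ofReal ((1 - θ) / π)) hQ hpos (fun p hp => by
        rw [← ENNReal.ofReal_mul (hpos p hp).le, mul_comm]
        exact ENNReal.ofReal_le_ofReal (hle p hp)) hB
    have h2 := volume_inter_Ioo_le (Q ⁻¹' B) (1 - π) (1 - π * Real.exp (-θ)) (1 - π * η)
    set K := volume (Q ⁻¹' B ∩ Set.Ioo (1 - π * Real.exp (-θ)) (1 - π * η)) with hK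
    have hKtop : K ≠ ⊤ := by
      refine ne_top_of_le_ne_top ?_ (measure_mono Set.inter_subset_right)
      rw [Real.volume_Ioo]
      exact ENNReal.ofReal_ne_top
    have h3 : (1 - θ) / π * K.toReal ≤ H.toReal := by
      have := ENNReal.toReal_mono hHtop h1
      rwa [ENNReal.toReal_mul, ENNReal.toReal_ofReal (div_nonneg (by linarith) hπ.le)] at this
    have hexp1 : 1 - θ ≤ Real.exp (-θ) := by linarith [Real.add_one_le_exp (-θ)]
    have hexp2 : Real.exp (-θ) ≤ 1 := by simpa using hθ
    have h4 : G.real B ≤ π⁻¹ * (π * θ + π * η + K.toReal) := by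
      rw [measureReal_def, hG, cond_apply measurableSet_Ioi, htail, hlaw B hB, ENNReal.toReal_mul,
        ENNReal.toReal_inv, ENNReal.toReal_ofReal hπ.le]
      refine mul_le_mul_of_nonneg_left ?_ (by positivity)
      have h5 := ENNReal.toReal_mono (by
        exact ENNReal.add_ne_top.2 ⟨ENNReal.add_ne_top.2
          ⟨ENNReal.ofReal_ne_top, ENNReal.ofReal_ne_top⟩, hKtop⟩) h2
      rw [ENNReal.toReal_add (ENNReal.add_ne_top.2
        ⟨ENNReal.ofReal_ne_top, ENNReal.ofReal_ne_top⟩) hKtop,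
        ENNReal.toReal_add ENNReal.ofReal_ne_top ENNReal.ofReal_ne_top,
        ENNReal.toReal_ofReal (by nlinarith), ENNReal.toReal_ofReal (by nlinarith)] at h5
      refine h5.trans ?_
      nlinarith
    have h5 : π⁻¹ * (π * θ + π * η + K.toReal) = θ + η + K.toReal / π := by
      field_simp
    rw [h5] at h4
    -- Since θ ≤ 1/2 and H ≤ 1, the ratio K/π is at most 2, so dropping the factor 1 - θ costs at
    -- most 2θ.
    have h6 : K.toReal / π ≤ 2 * θ + H.toReal := by
      have h7 : (1 - θ) * (K.toReal / π) ≤ H.toReal := by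
        calc (1 - θ) * (K.toReal / π) = (1 - θ) / π * K.toReal := by ring
          _ ≤ _ := h3
      have h8 : H.toReal ≤ 1 := by
        have := ENNReal.toReal_mono ENNReal.one_ne_top hH1
        simpa using this
      have h9 : 0 ≤ K.toReal / π := by positivity
      have h10 : K.toReal / π ≤ 2 := by nlinarith
      nlinarith
    linarith
  have hHB : (∫⁻ y in B, ENNReal.ofReal (f y)).toReal = ∫ y in B, f y := by
    rw [← ofReal_integral_eq_lintegral_ofReal hint (ae_of_all _ hf),
      ENNReal.toReal_ofReal (integral_nonneg hf)]
  have hHsum : (∫⁻ y in B, ENNReal.ofReal (f y)).toReal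
      + (∫⁻ y in Bᶜ, ENNReal.ofReal (f y)).toReal = 1 := by
    rw [← ENNReal.toReal_add (ne_top_of_le_ne_top ENNReal.one_ne_top
      (hf1 ▸ setLIntegral_le_lintegral B _)) (ne_top_of_le_ne_top ENNReal.one_ne_top
      (hf1 ▸ setLIntegral_le_lintegral Bᶜ _)), lintegral_add_compl _ hB, hf1]
    simp
  -- The upper bound for the complement is the lower bound for B, because both laws have total mass
  -- one.
  have h1 := hupper B hB
  have h2 := hupper Bᶜ hB.compl
  rw [probReal_compl_eq_one_sub hB] at h2
  rw [abs_le]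
  constructor <;> linarith

/-! ### Order statistics and counts -/

open scoped Classical in
lemma orderStat_le_iff {n : ℕ} (x : Fin n → ℝ) {i : ℕ} (hi : 1 ≤ i ∧ i ≤ n) (y : ℝ) :
    orderStat x i ≤ y ↔ i ≤ (Finset.univ.filter fun j => x j ≤ y).card := by
  rw [orderStat, dif_pos hi]
  have h := Tuple.lt_card_le_iff_apply_le_of_monotone (j := ⟨i - 1, by omega⟩) (a := y)
    (Tuple.monotone_sort x)
  simp only [Function.comp] at h
  rw [← h]
  have hcard : (Finset.univ.filter fun j => x (Tuple.sort x j) ≤ y).card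
      = (Finset.univ.filter fun j => x j ≤ y).card := by
    refine Finset.card_bij (fun j _ => Tuple.sort x j) (fun j hj => by simpa using hj)
      (fun a _ b _ hab => (Tuple.sort x).injective hab) (fun b hb => ?_)
    exact ⟨(Tuple.sort x).symm b, by simpa using hb, by simp⟩
  constructor
  · intro h1
    rw [← hcard]
    have : i - 1 < (Finset.univ.filter fun j => x (Tuple.sort x j) ≤ y).card := by
      convert h1
    omega
  · intro h1
    rw [← hcard] at h1
    have : i - 1 < (Finset.univ.filter fun j => x (Tuple.sort x j) ≤ y).card := by omega
    convert this

/-- The number of exceedances of `y` in a sample. -/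
noncomputable def exceedances {n : ℕ} (x : Fin n → ℝ) (y : ℝ) : ℝ :=
  ∑ i, (Set.Ioi y).indicator (fun _ => (1 : ℝ)) (x i)

/-- This turns events about the threshold into events about a sum of independent indicators. The
condition k < n keeps the index n - k at least 1, away from the default value 0 of `orderStat`. -/
lemma orderStat_sub_le_iff {n k : ℕ} (hk : k < n) (x : Fin n → ℝ) (y : ℝ) :
    orderStat x (n - k) ≤ y ↔ exceedances x y ≤ k := by
  classical
  rw [orderStat_le_iff x ⟨by omega, by omega⟩]
  have h1 : exceedances x y = ((Finset.univ.filter fun j => y < x j).card : ℝ) := by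
    simp [exceedances, Set.indicator_apply]
  rw [h1, Nat.cast_le]
  have h2 := Finset.card_filter_add_card_filter_not (s := (Finset.univ : Finset (Fin n)))
    (fun j => x j ≤ y)
  simp only [not_le, Finset.card_univ, Fintype.card_fin] at h2
  have h3 : (Finset.univ.filter fun j => x j ≤ y).card
    = (@Finset.filter (Fin n) (fun j => x j ≤ y) (fun j => Classical.propDecidable _)
        Finset.univ).card := by congr
  omega

variable {Ω : Type*} [MeasurableSpace Ω] {P : Measure Ω}
  {X : ℕ → Ω → ℝ}

/-- Chebyshev's inequality: each indicator has variance at most its mean, and the variances add by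
independence. -/
lemma measure_le_abs_exceedances_sub [IsProbabilityMeasure P] (hXmeas : ∀ i, Measurable (X i)) (hXindep : iIndepFun X P)
    (hXident : ∀ i, IdentDistrib (X i) (X 0) P P) (n : ℕ) (y : ℝ) {c : ℝ} (hc : 0 < c) :
    P {ω | c ≤ |exceedances (sample X n ω) y - n * (P.map (X 0)).real (Set.Ioi y)|}
      ≤ ENNReal.ofReal (n * (P.map (X 0)).real (Set.Ioi y) / c ^ 2) := by
  set p := (P.map (X 0)).real (Set.Ioi y) with hp
  have hg : Measurable ((Set.Ioi y).indicator fun _ => (1 : ℝ)) :=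
    measurable_const.indicator measurableSet_Ioi
  set Y : Fin n → Ω → ℝ := fun i ω => (Set.Ioi y).indicator (fun _ => (1 : ℝ)) (X i ω) with hY
  have hYm : ∀ i, Measurable (Y i) := fun i => hg.comp (hXmeas i)
  have hY01 : ∀ i ω, Y i ω = 0 ∨ Y i ω = 1 := fun i ω => by
    by_cases h : X i ω ∈ Set.Ioi y
    · exact Or.inr (Set.indicator_of_mem h _)
    · exact Or.inl (Set.indicator_of_notMem h _)
  have hYL : ∀ i, MemLp (Y i) 2 P := fun i =>
    MemLp.of_bound (hYm i).aestronglyMeasurable 1 (ae_of_all _ fun ω => by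
      rcases hY01 i ω with h | h <;> simp [h])
  have hYint : ∀ i, ∫ ω, Y i ω ∂P = p := fun i => by
    have h1 : Y i = (X i ⁻¹' Set.Ioi y).indicator (fun _ => (1 : ℝ)) := rfl
    rw [h1, integral_indicator_const _ (hXmeas i measurableSet_Ioi), hp, measureReal_def,
      measureReal_def, ← (hXident i).map_eq, Measure.map_apply (hXmeas i) measurableSet_Ioi]
    simp
  have hYvar : ∀ i, variance (Y i) P ≤ p := fun i => by
    refine (variance_le_expectation_sq (hYm i).aestronglyMeasurable).trans (le_of_eq ?_)
    rw [← hYint i]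
    refine integral_congr_ae (ae_of_all _ fun ω => ?_)
    rcases hY01 i ω with h | h <;> simp [h]
  have hind : Set.Pairwise (↑(Finset.univ : Finset (Fin n))) fun i j => IndepFun (Y i) (Y j) P :=
    fun i _ j _ hij => (hXindep.indepFun fun h => hij (Fin.ext h)).comp hg hg
  have hSL : MemLp (∑ i, Y i) 2 P := memLp_finsetSum' _ fun i _ => hYL i
  have hSint : ∫ ω, (∑ i, Y i) ω ∂P = n * p := by
    simp_rw [Finset.sum_apply]
    rw [integral_finsetSum _ fun i _ => (hYL i).integrable one_le_two]
    simp [hYint]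
  have hSvar : variance (∑ i, Y i) P ≤ n * p := by
    rw [IndepFun.variance_sum (fun i _ => hYL i) hind]
    refine (Finset.sum_le_sum fun i _ => hYvar i).trans ?_
    simp
  have hmain := meas_ge_le_variance_div_sq hSL hc
  rw [hSint] at hmain
  refine le_trans (le_of_eq ?_) (hmain.trans (ENNReal.ofReal_le_ofReal ?_))
  · congr 1
    ext ω
    simp [exceedances, sample, hY]
  · gcongr

/-! ### The conditional coverage -/

lemma measurable_sample (hXmeas : ∀ i, Measurable (X i)) (n : ℕ) : Measurable (sample X n) :=
  measurable_pi_lambda _ fun i => hXmeas i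

lemma indepFun_sample (hXmeas : ∀ i, Measurable (X i)) (hXindep : iIndepFun X P) (n : ℕ) :
    IndepFun (sample X n) (X n) P := by
  have h := hXindep.indepFun_finset (Finset.range n) {n} (by simp) hXmeas
  have h1 : Measurable fun (z : Finset.range n → ℝ) (i : Fin n) =>
      z ⟨i, Finset.mem_range.2 i.2⟩ :=
    measurable_pi_lambda _ fun i => measurable_pi_apply _
  have h2 : Measurable fun z : ({n} : Finset ℕ) → ℝ => z ⟨n, Finset.mem_singleton_self n⟩ :=
    measurable_pi_apply _
  exact h.comp h1 h2

/-- Given `X n > t`, the sample and `X n` remain independent, the law of the sample does not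
change, and `X n` follows the conditional law. -/
lemma map_cond_sample_prod [IsProbabilityMeasure P] (hXmeas : ∀ i, Measurable (X i)) (hXindep : iIndepFun X P) (n : ℕ)
    (t : ℝ) :
    (P[|X n ⁻¹' Set.Ioi t]).map (fun ω => (sample X n ω, X n ω))
      = (P.map (sample X n)).prod ((P.map (X n))[|Set.Ioi t]) := by
  have hs := measurable_sample hXmeas n
  have := Measure.isProbabilityMeasure_map (μ := P) hs.aemeasurable
  have := Measure.isProbabilityMeasure_map (μ := P) (hXmeas n).aemeasurable
  refine (Measure.prod_eq fun S T hS hT => ?_).symm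
  rw [Measure.map_apply (hs.prodMk (hXmeas n)) (hS.prod hT),
    cond_apply (hXmeas n measurableSet_Ioi), cond_apply measurableSet_Ioi,
    Measure.map_apply hs hS, Measure.map_apply (hXmeas n) measurableSet_Ioi,
    Measure.map_apply (hXmeas n) (measurableSet_Ioi.inter hT)]
  have h1 : X n ⁻¹' Set.Ioi t ∩ (fun ω => (sample X n ω, X n ω)) ⁻¹' S ×ˢ T
      = sample X n ⁻¹' S ∩ X n ⁻¹' (Set.Ioi t ∩ T) := by
    ext ω
    simp only [Set.mem_inter_iff, Set.mem_preimage, Set.mem_prod]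
    tauto
  rw [h1, indepFun_iff_measure_inter_preimage_eq_mul.1 (indepFun_sample hXmeas hXindep n) _ _ hS
    (measurableSet_Ioi.inter hT)]
  ring

/-- The conditional coverage of a sample-dependent region is its measure under the conditional law
of an observation above the threshold. -/
lemma conditionalCoverage_ae_eq [IsProbabilityMeasure P] (hXmeas : ∀ i, Measurable (X i)) (hXindep : iIndepFun X P)
    (n : ℕ) {t : ℝ} (ht : P (X n ⁻¹' Set.Ioi t) ≠ 0) {R : (Fin n → ℝ) → Set ℝ}
    (hR : MeasurableSet {p : (Fin n → ℝ) × ℝ | p.2 ∈ R p.1}) :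
    conditionalCoverage P X n t R
      =ᵐ[P] fun ω => ((P.map (X n))[|Set.Ioi t]).real (R (sample X n ω)) := by
  have hs := measurable_sample hXmeas n
  have hm : sampleSigma X n ≤ ‹MeasurableSpace Ω› := hs.comap_le
  have hmap := map_cond_sample_prod hXmeas hXindep n t
  have hP1 := Measure.isProbabilityMeasure_map (μ := P) hs.aemeasurable
  have hP2 := Measure.isProbabilityMeasure_map (μ := P) (hXmeas n).aemeasurable
  have hP' : IsProbabilityMeasure (P[|X n ⁻¹' Set.Ioi t]) := cond_isProbabilityMeasure ht
  have hG : IsProbabilityMeasure ((P.map (X n))[|Set.Ioi t]) :=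
    cond_isProbabilityMeasure (by rwa [Measure.map_apply (hXmeas n) measurableSet_Ioi])
  set P' := P[|X n ⁻¹' Set.Ioi t] with hP'def
  set G := (P.map (X n))[|Set.Ioi t] with hGdef
  set ν := P.map (sample X n) with hν
  set A := {p : (Fin n → ℝ) × ℝ | p.2 ∈ R p.1} with hA
  set φ : (Fin n → ℝ) → ℝ := fun x => G.real (R x) with hφ
  have hφm : Measurable φ := (measurable_measure_prodMk_left hR).ennreal_toReal
  have hmap1 : P'.map (sample X n) = ν := by
    have h1 : sample X n = Prod.fst ∘ fun ω => (sample X n ω, X n ω) := rfl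
    rw [h1, ← Measure.map_map measurable_fst (hs.prodMk (hXmeas n)), hmap, Measure.map_fst_prod]
    simp
  have hE : MeasurableSet {ω | X n ω ∈ R (sample X n ω)} := (hs.prodMk (hXmeas n)) hR
  have hφb : ∀ x, ‖φ x‖ ≤ 1 := fun x => by
    rw [Real.norm_eq_abs, abs_of_nonneg measureReal_nonneg]
    exact measureReal_le_one
  have hgint : Integrable (fun ω => φ (sample X n ω)) P' :=
    Integrable.of_bound (hφm.comp hs).aestronglyMeasurable 1 (ae_of_all _ fun ω => hφb _)
  have hgm : StronglyMeasurable[sampleSigma X n] fun ω => φ (sample X n ω) :=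
    (hφm.comp (comap_measurable (sample X n))).stronglyMeasurable
  have hcond : (fun ω => φ (sample X n ω))
      =ᵐ[P'] P'⟦{ω | X n ω ∈ R (sample X n ω)} | sampleSigma X n⟧ := by
    refine ae_eq_condExp_of_forall_setIntegral_eq hm
      ((integrable_const (1 : ℝ)).indicator hE) (fun s _ _ => hgint.integrableOn) ?_
      hgm.aestronglyMeasurable
    rintro _ ⟨S, hS, rfl⟩ -
    have h1 : ∫ ω in sample X n ⁻¹' S, φ (sample X n ω) ∂P' = ∫ x in S, φ x ∂ν := by
      rw [← hmap1, setIntegral_map hS hφm.aestronglyMeasurable hs.aemeasurable]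
    have h2 : ∫ ω in sample X n ⁻¹' S,
        {ω | X n ω ∈ R (sample X n ω)}.indicator (fun _ => (1 : ℝ)) ω ∂P'
        = ((ν.prod G) ((S ×ˢ Set.univ) ∩ A)).toReal := by
      rw [integral_indicator_const _ hE, smul_eq_mul, mul_one, measureReal_restrict_apply hE,
        ← hmap, Measure.map_apply (hs.prodMk (hXmeas n)) ((hS.prod MeasurableSet.univ).inter hR),
        measureReal_def]
      congr 2
      ext ω
      simp [hA, and_comm]
    rw [h1, h2, Measure.prod_apply ((hS.prod MeasurableSet.univ).inter hR)]
    have h3 : ∀ x, G (Prod.mk x ⁻¹' ((S ×ˢ Set.univ) ∩ A))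
        = S.indicator (fun x => ENNReal.ofReal (φ x)) x := by
      intro x
      by_cases hx : x ∈ S
      · rw [Set.indicator_of_mem hx, hφ, ofReal_measureReal]
        congr 1
        ext y
        simp [hA, hx]
      · rw [Set.indicator_of_notMem hx]
        have : Prod.mk x ⁻¹' ((S ×ˢ Set.univ) ∩ A) = ∅ := by
          ext y
          simp [hx]
        rw [this, measure_empty]
    simp_rw [h3]
    rw [lintegral_indicator hS, integral_eq_lintegral_of_nonneg_ae
      (ae_of_all _ fun x => measureReal_nonneg) hφm.aestronglyMeasurable]
  -- The identity is known almost surely only under the conditioned measure. Its exceptional set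
  -- belongs to the σ-algebra of the sample, whose law conditioning does not change, so it is also
  -- null under P.
  have hN : MeasurableSet[sampleSigma X n] {ω | φ (sample X n ω)
      = (P'⟦{ω | X n ω ∈ R (sample X n ω)} | sampleSigma X n⟧) ω} :=
    hgm.measurableSet_eq_fun stronglyMeasurable_condExp
  obtain ⟨S, hS, hSeq⟩ := hN.compl
  have h1 : P' (sample X n ⁻¹' S) = 0 := by
    rw [hSeq]
    exact hcond
  have h2 : P (sample X n ⁻¹' S) = 0 := by
    rw [← Measure.map_apply hs hS, ← hν, ← hmap1, Measure.map_apply hs hS, h1]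
  rw [hSeq] at h2
  have h3 : (fun ω => φ (sample X n ω))
      =ᵐ[P] P'⟦{ω | X n ω ∈ R (sample X n ω)} | sampleSigma X n⟧ := h2
  exact h3.symm

/-! ### Regular tails -/

/-- Above the log-level `x₁` the tail quantile function has a positive derivative, whose
logarithmic derivative is `γ + A (exp x)`. -/
structure RegularTail (Q A : ℝ → ℝ) (γ x₁ : ℝ) : Prop where
  pos : 0 < x₁
  hasDerivAt_quantile : ∀ x, x₁ ≤ x →
    HasDerivAt Q (deriv Q (1 - Real.exp (-x))) (1 - Real.exp (-x))
  hasDerivAt : ∀ x, x₁ ≤ x → HasDerivAt (tailQuantile Q) (tailSlope Q x) x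
  slope_pos : ∀ x, x₁ ≤ x → 0 < tailSlope Q x
  hasDerivAt_log : ∀ x, x₁ ≤ x →
    HasDerivAt (fun x => Real.log (tailSlope Q x)) (γ + A (Real.exp x)) x

namespace RegularTail

variable {Q A : ℝ → ℝ} {γ x₁ : ℝ}

lemma deriv_pos (h : RegularTail Q A γ x₁) {x : ℝ} (hx : x₁ ≤ x) :
    0 < deriv Q (1 - Real.exp (-x)) :=
  pos_of_mul_pos_left (h.slope_pos x hx) (Real.exp_pos _).le

lemma exists_eq_of_mem {x p : ℝ} (hp : p ∈ Set.Ico (1 - Real.exp (-x)) 1) :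
    ∃ y, x ≤ y ∧ p = 1 - Real.exp (-y) := by
  have h1 : 0 < 1 - p := by linarith [hp.2]
  refine ⟨-Real.log (1 - p), ?_, by rw [neg_neg, Real.exp_log h1]; ring⟩
  have : Real.log (1 - p) ≤ -x := (Real.log_le_iff_le_exp h1).2 (by linarith [hp.1])
  linarith

lemma strictMonoOn (h : RegularTail Q A γ x₁) {x : ℝ} (hx : x₁ ≤ x) :
    StrictMonoOn Q (Set.Ico (1 - Real.exp (-x)) 1) := by
  refine strictMonoOn_of_deriv_pos (convex_Ico _ _) (fun p hp => ?_) fun p hp => ?_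
  · obtain ⟨y, hy, rfl⟩ := exists_eq_of_mem hp
    exact (h.hasDerivAt_quantile y (hx.trans hy)).continuousAt.continuousWithinAt
  · obtain ⟨y, hy, rfl⟩ := exists_eq_of_mem (interior_subset hp)
    exact h.deriv_pos (hx.trans hy)

lemma measure_Ioi_tailQuantile {μ : Measure ℝ} [IsProbabilityMeasure μ]
    (h : RegularTail Q A γ x₁) (hQ : Q = quantile fun x => cdf μ x) {x : ℝ} (hx : x₁ ≤ x) :
    μ (Set.Ioi (tailQuantile Q x)) = ENNReal.ofReal (Real.exp (-x)) := by
  have hx0 : 0 < x := h.pos.trans_le hx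
  have hp : 1 - Real.exp (-x) ∈ Set.Ioo (0 : ℝ) 1 := by
    have h1 : Real.exp (-x) < 1 := by simpa using hx0
    have h2 := Real.exp_pos (-x)
    constructor <;> linarith
  have hm := h.strictMonoOn hx
  subst hQ
  have := measure_inter_Ioi_quantile μ hp hm MeasurableSet.univ
  rw [Set.inter_univ, Set.preimage_univ, Set.univ_inter, Real.volume_Ioo] at this
  rw [tailQuantile, this]
  congr 1
  ring

/-- The tail quantile function is locally Lipschitz at the scale of its derivative. -/
lemma exists_abs_sub_le (h : RegularTail Q A γ x₁) (hA : Tendsto A atTop (𝓝 0)) :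
    ∃ C x₂ : ℝ, 0 < C ∧ ∀ x, x₂ ≤ x → ∀ y, |y - x| ≤ 1 →
      |tailQuantile Q y - tailQuantile Q x| ≤ C * tailSlope Q x * |y - x| := by
  have h1 : ∀ᶠ x in atTop, |A (Real.exp x)| < 1 := by
    have := (hA.comp Real.tendsto_exp_atTop).eventually (Metric.ball_mem_nhds 0 one_pos)
    filter_upwards [this] with x hx
    simpa using hx
  obtain ⟨x₃, hx₃⟩ := eventually_atTop.1 h1
  refine ⟨Real.exp (|γ| + 1), max x₁ x₃ + 1, Real.exp_pos _, fun x hx y hy => ?_⟩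
  have hIcc : ∀ z ∈ Set.Icc (x - 1) (x + 1), x₁ ≤ z ∧ x₃ ≤ z := fun z hz =>
    ⟨by linarith [hz.1, le_max_left x₁ x₃], by linarith [hz.1, le_max_right x₁ x₃]⟩
  have hxm : x ∈ Set.Icc (x - 1) (x + 1) := ⟨by linarith, by linarith⟩
  have hym : y ∈ Set.Icc (x - 1) (x + 1) := by
    have := abs_le.1 hy
    exact ⟨by linarith, by linarith⟩
  -- The logarithmic derivative γ + A is at most |γ| + 1 in absolute value here, so the slope varies
  -- by at most a constant factor over unit distance.
  have hlog : ∀ z ∈ Set.Icc (x - 1) (x + 1),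
      Real.log (tailSlope Q z) - Real.log (tailSlope Q x) ≤ |γ| + 1 := by
    intro z hz
    have h2 := (convex_Icc (x - 1) (x + 1)).norm_image_sub_le_of_norm_hasDerivWithin_le
      (f := fun x => Real.log (tailSlope Q x)) (C := |γ| + 1)
      (fun w hw => (h.hasDerivAt_log w (hIcc w hw).1).hasDerivWithinAt)
      (fun w hw => (abs_add_le _ _).trans (by linarith [hx₃ w (hIcc w hw).2])) hxm hz
    have h3 : |z - x| ≤ 1 := abs_le.2 ⟨by linarith [hz.1], by linarith [hz.2]⟩
    refine (le_abs_self _).trans (h2.trans ?_)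
    rw [Real.norm_eq_abs]
    nlinarith [abs_nonneg γ]
  have hslope : ∀ z ∈ Set.Icc (x - 1) (x + 1),
      ‖tailSlope Q z‖ ≤ Real.exp (|γ| + 1) * tailSlope Q x := by
    intro z hz
    have hpz := h.slope_pos z (hIcc z hz).1
    have hpx := h.slope_pos x (hIcc x hxm).1
    rw [Real.norm_eq_abs, abs_of_pos hpz, ← Real.log_le_log_iff hpz (by positivity),
      Real.log_mul (Real.exp_pos _).ne' hpx.ne', Real.log_exp]
    linarith [hlog z hz]
  exact (convex_Icc (x - 1) (x + 1)).norm_image_sub_le_of_norm_hasDerivWithin_le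
    (fun w hw => (h.hasDerivAt w (hIcc w hw).1).hasDerivWithinAt) hslope hxm hym

end RegularTail

lemma VonMisesSecondOrder.exists_regularTail {μ : Measure ℝ} [IsProbabilityMeasure μ]
    {Q a : ℝ → ℝ} {γ ρ : ℝ} (hQ : Q = quantile fun x => cdf μ x)
    (h : VonMisesSecondOrder (fun x => cdf μ x) a γ ρ) :
    ∃ x₁ : ℝ, RegularTail Q (vonMisesRate Q γ) γ x₁ := by
  obtain ⟨x₁, h0, h1⟩ := h.exists_hasDerivAt hQ
  exact ⟨x₁, h0, fun x hx => (h1 x hx).1, fun x hx => (h1 x hx).2.1,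
    fun x hx => (h1 x hx).2.2.1, fun x hx => (h1 x hx).2.2.2⟩

/-! ### Intermediate order statistics -/

section OrderStat

variable {Ω : Type*} [MeasurableSpace Ω] {P : Measure Ω} [IsProbabilityMeasure P]
  {X : ℕ → Ω → ℝ} {Q A : ℝ → ℝ} {γ x₁ : ℝ}

/-- The expected number of exceedances of q(x ± b) is k e^{∓b}. If the order statistic leaves the
interval, that count crosses k, hence deviates from its mean by kb/2 above (as e^{-b} ≤ 1 - b/2) or
by kb below (as e^b ≥ 1 + b). Each deviation has probability at most 4 / (k b²). -/
lemma measure_orderStat_notMem_le (hXmeas : ∀ i, Measurable (X i)) (hXindep : iIndepFun X P)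
    (hXident : ∀ i, IdentDistrib (X i) (X 0) P P)
    (hQ : Q = quantile fun x => cdf (P.map (X 0)) x) (h : RegularTail Q A γ x₁) {n k : ℕ}
    (hk0 : 0 < k) (hk : k < n) {x b : ℝ} (hx : x₁ + 1 ≤ x) (hxk : Real.exp (-x) = k / n)
    (hb : 0 < b) (hb1 : b ≤ 1) :
    P {ω | orderStat (sample X n ω) (n - k) ∉
        Set.Icc (tailQuantile Q (x - b)) (tailQuantile Q (x + b))}
      ≤ ENNReal.ofReal (8 / (k * b ^ 2)) := by
  have := Measure.isProbabilityMeasure_map (μ := P) (hXmeas 0).aemeasurable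
  have hkR : (0 : ℝ) < k := Nat.cast_pos.2 hk0
  have hnR : (0 : ℝ) < n := Nat.cast_pos.2 (by omega)
  have hmean : ∀ s : ℝ, x₁ ≤ x + s →
      n * (P.map (X 0)).real (Set.Ioi (tailQuantile Q (x + s))) = k * Real.exp (-s) := by
    intro s hs
    rw [measureReal_def, h.measure_Ioi_tailQuantile hQ hs, ENNReal.toReal_ofReal (Real.exp_pos _).le,
      neg_add, Real.exp_add, hxk]
    field_simp
  have hm1 := hmean b (by linarith)
  have hm2 := hmean (-b) (by linarith)
  rw [neg_neg, ← sub_eq_add_neg] at hm2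
  have hup := measure_le_abs_exceedances_sub hXmeas hXindep hXident n (tailQuantile Q (x + b))
    (c := k * b / 2) (by positivity)
  have hlow := measure_le_abs_exceedances_sub hXmeas hXindep hXident n (tailQuantile Q (x - b))
    (c := k * b) (by positivity)
  rw [hm1] at hup
  rw [hm2] at hlow
  have he1 : Real.exp (-b) ≤ 1 - b / 2 := by
    rw [Real.exp_neg, inv_le_iff_one_le_mul₀ (Real.exp_pos b)]
    nlinarith [Real.add_one_le_exp b]
  have he2 : b + 1 ≤ Real.exp b := Real.add_one_le_exp b
  have he3 : Real.exp b ≤ 4 :=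
    (Real.exp_le_exp.2 hb1).trans (Real.exp_one_lt_d9.le.trans (by norm_num))
  have hsub : {ω | orderStat (sample X n ω) (n - k) ∉
        Set.Icc (tailQuantile Q (x - b)) (tailQuantile Q (x + b))} ⊆
      {ω | k * b / 2 ≤ |exceedances (sample X n ω) (tailQuantile Q (x + b)) - k * Real.exp (-b)|} ∪
      {ω | k * b ≤ |exceedances (sample X n ω) (tailQuantile Q (x - b)) - k * Real.exp b|} := by
    intro ω hω
    rw [Set.mem_ofPred_eq, Set.mem_Icc, not_and_or] at hω
    rcases hω with hω | hω
    · right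
      have h1 := (orderStat_sub_le_iff hk _ _).1 (not_le.1 hω).le
      rw [Set.mem_ofPred_eq, abs_sub_comm]
      refine le_trans ?_ (le_abs_self _)
      nlinarith
    · left
      rw [orderStat_sub_le_iff hk, not_le] at hω
      rw [Set.mem_ofPred_eq]
      refine le_trans ?_ (le_abs_self _)
      nlinarith
  refine (measure_mono hsub).trans ((measure_union_le _ _).trans ((add_le_add hup hlow).trans ?_))
  rw [← ENNReal.ofReal_add (by positivity) (by positivity)]
  refine ENNReal.ofReal_le_ofReal ?_
  have h1 : k * Real.exp (-b) / (k * b / 2) ^ 2 ≤ 4 / (k * b ^ 2) := by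
    rw [div_le_div_iff₀ (by positivity) (by positivity)]
    have : Real.exp (-b) ≤ 1 := by linarith
    nlinarith [mul_le_mul_of_nonneg_left this (show 0 ≤ (k : ℝ) ^ 2 * b ^ 2 by positivity)]
  have h2 : k * Real.exp b / (k * b) ^ 2 ≤ 4 / (k * b ^ 2) := by
    rw [div_le_div_iff₀ (by positivity) (by positivity)]
    nlinarith [mul_le_mul_of_nonneg_left he3 (show 0 ≤ (k : ℝ) ^ 2 * b ^ 2 by positivity)]
  calc _ ≤ 4 / (k * b ^ 2) + 4 / (k * b ^ 2) := add_le_add h1 h2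
    _ = _ := by ring

/-- Intermediate order statistics concentrate around the corresponding quantile. -/
lemma exists_measure_lt_abs_orderStat_sub_le (hXmeas : ∀ i, Measurable (X i))
    (hXindep : iIndepFun X P) (hXident : ∀ i, IdentDistrib (X i) (X 0) P P)
    (hQ : Q = quantile fun x => cdf (P.map (X 0)) x) (h : RegularTail Q A γ x₁)
    (hA : Tendsto A atTop (𝓝 0)) :
    ∃ C x₂ : ℝ, 0 < C ∧ ∀ (n k : ℕ) (x b : ℝ), 0 < k → k < n → x₂ ≤ x → Real.exp (-x) = k / n →
      0 < b → b ≤ 1 →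
      P {ω | C * tailSlope Q x * b < |orderStat (sample X n ω) (n - k) - tailQuantile Q x|}
        ≤ ENNReal.ofReal (8 / (k * b ^ 2)) := by
  obtain ⟨C, x₂, hC, hlip⟩ := h.exists_abs_sub_le hA
  refine ⟨C, max x₂ (x₁ + 1), hC, fun n k x b hk0 hk hx hxk hb hb1 => ?_⟩
  refine le_trans (measure_mono fun ω hω => ?_) (measure_orderStat_notMem_le hXmeas hXindep hXident
    hQ h hk0 hk ((le_max_right _ _).trans hx) hxk hb hb1)
  rw [Set.mem_ofPred_eq] at hω ⊢
  intro hmem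
  have h1 := hlip x ((le_max_left _ _).trans hx) (x - b) (by simpa [abs_of_pos hb] using hb1)
  have h2 := hlip x ((le_max_left _ _).trans hx) (x + b) (by simpa [abs_of_pos hb] using hb1)
  rw [sub_sub_cancel_left, abs_neg, abs_of_pos hb] at h1
  rw [add_sub_cancel_left, abs_of_pos hb] at h2
  refine absurd hω (not_lt.2 (abs_le.2 ⟨?_, ?_⟩))
  · linarith [(abs_le.1 h1).1, hmem.1]
  · linarith [(abs_le.1 h2).2, hmem.2]

end OrderStat

/-! ### The scaling function -/

/-- Under the second-order condition, the scaling function agrees with the derivative of the tail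
quantile function up to a relative error of the order of `A`. -/
lemma SecondOrderCondition.exists_abs_div_sub_one_le {Q a A : ℝ → ℝ} {γ ρ x₁ : ℝ}
    (hSO : SecondOrderCondition Q a A γ ρ) (hAm : Measurable A) (h : RegularTail Q A γ x₁) :
    ∃ C x₂ : ℝ, 0 < C ∧ ∀ x, x₂ ≤ x → 0 < a (Real.exp x) ∧
      |a (Real.exp x) / tailSlope Q x - 1| ≤ C * |A (Real.exp x)| := by
  obtain ⟨ha, hA0, hρ, hRV, hlim⟩ := hSO
  obtain ⟨C₁, t₀, hC₁, ht₀, hpot⟩ := hRV.exists_le_mul_exp hAm one_pos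
  set C₂ := C₁ * Real.exp 1 with hC₂
  have hC₂0 : 0 < C₂ := by positivity
  -- The increment q(x + 1) - q(x) is estimated twice: divided by a, through the limit condition at
  -- the point e^{-1}, whose limit J enters only through |J|; divided by the slope, by integrating
  -- the von Mises equation. Both quotients are `boxCox γ 1` up to O(A), which compares a with the
  -- slope.
  obtain ⟨C₃, hC₃, hlim3⟩ : ∃ C₃ : ℝ, 0 < C₃ ∧ ∀ᶠ x in atTop,
      |(tailQuantile Q (x + 1) - tailQuantile Q x) / a (Real.exp x) - boxCox γ 1|
        ≤ C₃ * |A (Real.exp x)| := by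
    have h1 := hlim (Real.exp (-1)) (Real.exp_pos _)
    set J := ∫ v in (1 : ℝ)..(1 / Real.exp (-1)), v ^ (γ - 1) * ∫ r in (1 : ℝ)..v, r ^ (ρ - 1)
    have hexp0 : Tendsto (fun x : ℝ => Real.exp (-x)) atTop (𝓝[>] 0) :=
      tendsto_nhdsWithin_iff.2 ⟨Real.tendsto_exp_neg_atTop_nhds_zero,
        Eventually.of_forall fun x => Real.exp_pos _⟩
    have h2 := ((h1.comp hexp0).abs).eventually (gt_mem_nhds (lt_add_one |J|))
    refine ⟨|J| + 1, by positivity, ?_⟩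
    filter_upwards [h2, Real.tendsto_exp_atTop.eventually hRV.eventually_ne] with x hx hne
    simp only [Function.comp] at hx
    have he : 1 / Real.exp (-x) = Real.exp x := by rw [Real.exp_neg, one_div, inv_inv]
    have hgp : gpQuantile γ (Real.exp (-1)) = boxCox γ 1 := by
      rw [gpQuantile_eq_boxCox (Real.exp_pos _), Real.log_exp, neg_neg]
    rw [he, hgp, ← Real.exp_add, ← neg_add, abs_mul, abs_div, abs_one, one_div,
      inv_mul_lt_iff₀ (lt_of_le_of_ne (abs_nonneg _) (Ne.symm hne))] at hx
    rw [mul_comm]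
    exact hx.le
  set b := boxCox γ 1 with hb
  have hbpos : 0 < b := by
    have := boxCox_strictMono γ one_pos
    rwa [boxCox_zero] at this
  set C₄ := 2 * C₂ * Real.exp |γ| with hC₄
  have hC₄0 : 0 < C₄ := by positivity
  have hsmall : ∀ᶠ x in atTop, |A (Real.exp x)| < min (1 / C₂) (min (b / (2 * C₃)) (b / C₄)) := by
    have := (hA0.comp Real.tendsto_exp_atTop).eventually (Metric.ball_mem_nhds 0
      (show 0 < min (1 / C₂) (min (b / (2 * C₃)) (b / C₄)) by positivity))
    filter_upwards [this] with x hx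
    simpa using hx
  obtain ⟨x₂, hx₂⟩ := eventually_atTop.1 ((Real.tendsto_exp_atTop.eventually ha).and
    (hlim3.and (hsmall.and ((eventually_ge_atTop x₁).and
      (Real.tendsto_exp_atTop.eventually (eventually_ge_atTop t₀))))))
  refine ⟨(C₄ + 4 * C₃) / b, x₂, by positivity, fun x hx => ?_⟩
  obtain ⟨hapos, hl3, hsm, hx1, hxt⟩ := hx₂ x hx
  refine ⟨hapos, ?_⟩
  have hδ1 : C₂ * |A (Real.exp x)| ≤ 1 := by
    have := hsm.le.trans (min_le_left _ _)
    rwa [le_div_iff₀ hC₂0, mul_comm] at this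
  have hδ2 : C₃ * |A (Real.exp x)| ≤ b / 2 := by
    have := hsm.le.trans ((min_le_right _ _).trans (min_le_left _ _))
    rw [le_div_iff₀ (by positivity)] at this
    linarith
  have hδ3 : C₄ * |A (Real.exp x)| ≤ b := by
    have := hsm.le.trans ((min_le_right _ _).trans (min_le_right _ _))
    rwa [le_div_iff₀ (by positivity), mul_comm] at this
  set δ := |A (Real.exp x)| with hδ
  have hδ0 : 0 ≤ δ := abs_nonneg _
  have hs := h.slope_pos x hx1
  have hx1v : ∀ v ∈ Set.Icc (0 : ℝ) 1, x₁ ≤ x + v := fun v hv => by linarith [hv.1]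
  have hAle : ∀ v ∈ Set.Icc (0 : ℝ) 1, |A (Real.exp (x + v))| ≤ C₂ * δ := by
    intro v hv
    rw [Real.exp_add]
    refine (hpot _ hxt v hv.1).trans ?_
    refine mul_le_mul_of_nonneg_right (mul_le_mul_of_nonneg_left (Real.exp_le_exp.2 ?_) hC₁.le) hδ0
    nlinarith [hv.1, hv.2]
  have hlog := abs_sub_sub_mul_le (f := fun v => Real.log (tailSlope Q (x + v)))
    (B := fun v => A (Real.exp (x + v))) (γ := γ)
    (fun v hv => (h.hasDerivAt_log (x + v) (hx1v v hv)).comp_const_add x v) hAle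
  simp only [add_zero] at hlog
  have hD := abs_le_of_hasDerivAt_le (V := 1)
    (D := fun v => (tailQuantile Q (x + v) - tailQuantile Q x) / tailSlope Q x - boxCox γ v)
    (D' := fun v => tailSlope Q (x + v) / tailSlope Q x - Real.exp (γ * v))
    (B := fun v => C₄ * δ * v) (B' := fun _ => C₄ * δ)
    (fun v hv => ((((h.hasDerivAt (x + v) (hx1v v hv)).comp_const_add x v).sub_const _).div_const
      _).sub (hasDerivAt_boxCox γ v))
    (fun v => by simpa using (hasDerivAt_id' v).const_mul (C₄ * δ))
    (by simp [boxCox_zero])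
    (fun v hv => by
      have hpv := h.slope_pos (x + v) (hx1v v hv)
      have h1 : tailSlope Q (x + v) / tailSlope Q x = Real.exp (γ * v) *
          Real.exp (Real.log (tailSlope Q (x + v)) - Real.log (tailSlope Q x) - γ * v) := by
        rw [← Real.exp_add, add_sub_cancel, Real.exp_sub, Real.exp_log hpv, Real.exp_log hs]
      have h2 := hlog v hv
      have h3 : C₂ * δ * v ≤ C₂ * δ := mul_le_of_le_one_right (by positivity) hv.2
      rw [h1, ← mul_sub_one, abs_mul, abs_of_pos (Real.exp_pos _)]
      have h4 : Real.exp (γ * v) ≤ Real.exp |γ| := by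
        refine Real.exp_le_exp.2 ?_
        nlinarith [le_abs_self γ, abs_nonneg γ, hv.1, hv.2]
      have h5 := abs_exp_sub_one_le_two_mul (h2.trans (h3.trans hδ1))
      calc _ ≤ Real.exp |γ| * (2 * (C₂ * δ)) :=
            mul_le_mul h4 (h5.trans (by linarith)) (abs_nonneg _) (Real.exp_pos _).le
        _ = C₄ * δ := by rw [hC₄]; ring) 1 ⟨zero_le_one, le_rfl⟩
  simp only [mul_one] at hD
  rw [← hb] at hD
  set T := tailQuantile Q (x + 1) - tailQuantile Q x
  set r := a (Real.exp x) / tailSlope Q x with hr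
  have hrpos : 0 < r := div_pos hapos hs
  set q := T / a (Real.exp x) with hq
  have hTr : T / tailSlope Q x = r * q := by rw [hr, hq]; field_simp
  rw [hTr] at hD
  have hq1 := abs_le.1 hl3
  have hD1 := abs_le.1 hD
  -- Here r q ≤ 2b while q ≥ b/2.
  have hr4 : r ≤ 4 := by nlinarith
  rw [div_mul_eq_mul_div, le_div_iff₀ hbpos]
  have h1 : |r * (q - b)| ≤ 4 * (C₃ * δ) := by
    rw [abs_mul, abs_of_pos hrpos]
    exact mul_le_mul hr4 hl3 (abs_nonneg _) (by norm_num)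
  calc |r - 1| * b = |(r * q - b) - r * (q - b)| := by
        rw [← abs_of_pos hbpos, ← abs_mul, abs_of_pos hbpos]
        ring_nf
    _ ≤ |r * q - b| + |r * (q - b)| := abs_sub _ _
    _ ≤ (C₄ + 4 * C₃) * δ := by linarith

/-! ### Bounds along the sequence of levels -/

/-- If ρ < 0, the Potter bound with δ = -ρ has no exponential growth and covers all of [0, L]. If ρ
= 0, every Potter bound grows with w, so L must be bounded or |A| monotone. Beyond L a Potter bound
with δ = 1/2 is restarted at x + L, and the overshoot costs e^{E/2}. -/
lemma RegularlyVaryingAtTop.exists_eventually_abs_le {A : ℝ → ℝ} {ρ : ℝ} (hAm : Measurable A)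
    (hRV : RegularlyVaryingAtTop (fun t => |A t|) ρ) (hρ : ρ ≤ 0) {x L : ℕ → ℝ}
    (hx : Tendsto x atTop atTop) (hL : ∀ᶠ n in atTop, 0 ≤ L n)
    (hmono : ρ = 0 → (∃ B, ∀ᶠ n in atTop, L n ≤ B) ∨
      ∃ t₀ : ℝ, AntitoneOn (fun t => |A t|) (Set.Ici t₀)) :
    ∃ C : ℝ, 0 < C ∧ ∀ᶠ n in atTop, ∀ E, 0 ≤ E → ∀ w ∈ Set.Icc 0 (L n + E),
      |A (Real.exp (x n + w))| ≤ C * Real.exp (E / 2) * |A (Real.exp (x n))| := by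
  have hexp : Tendsto (fun n => Real.exp (x n)) atTop atTop := Real.tendsto_exp_atTop.comp hx
  have hstep : ∃ C₁ : ℝ, 0 < C₁ ∧ ∀ᶠ n in atTop, ∀ w ∈ Set.Icc 0 (L n),
      |A (Real.exp (x n + w))| ≤ C₁ * |A (Real.exp (x n))| := by
    rcases hρ.lt_or_eq with hneg | h0
    · obtain ⟨C, t₀, hC, -, h⟩ := hRV.exists_le_mul_exp hAm (neg_pos.2 hneg)
      refine ⟨C, hC, ?_⟩
      filter_upwards [hexp.eventually (eventually_ge_atTop t₀)] with n hn w hw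
      have := h _ hn w hw.1
      rw [add_neg_cancel, zero_mul, Real.exp_zero, mul_one] at this
      rwa [Real.exp_add]
    · rcases hmono h0 with ⟨B, hB⟩ | ⟨t₀, ht₀⟩
      · obtain ⟨C, t₀, hC, -, h⟩ := hRV.exists_le_mul_exp hAm one_pos
        refine ⟨C * Real.exp B, by positivity, ?_⟩
        filter_upwards [hexp.eventually (eventually_ge_atTop t₀), hB] with n hn hLB w hw
        have := h _ hn w hw.1
        rw [h0, zero_add, one_mul] at this
        rw [Real.exp_add]
        refine this.trans ?_
        have := hw.2.trans hLB
        gcongr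
      · refine ⟨1, one_pos, ?_⟩
        filter_upwards [hexp.eventually (eventually_ge_atTop t₀)] with n hn w hw
        have h1 : Real.exp (x n) ≤ Real.exp (x n + w) := Real.exp_le_exp.2 (by linarith [hw.1])
        rw [one_mul]
        exact ht₀ hn (hn.trans h1) h1
  obtain ⟨C₁, hC₁, h1⟩ := hstep
  obtain ⟨C₂, t₀, hC₂, -, h2⟩ := hRV.exists_le_mul_exp hAm (δ := 1 / 2) (by norm_num)
  refine ⟨C₁ * (1 + C₂), by positivity, ?_⟩
  filter_upwards [h1, hL, hexp.eventually (eventually_ge_atTop t₀)] with n hn hLn hxn E hE w hw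
  have hE1 : 1 ≤ Real.exp (E / 2) := Real.one_le_exp (by positivity)
  have hA0 := abs_nonneg (A (Real.exp (x n)))
  rcases le_total w (L n) with hwL | hwL
  · refine (hn w ⟨hw.1, hwL⟩).trans ?_
    refine mul_le_mul_of_nonneg_right ?_ hA0
    have : 1 ≤ (1 + C₂) * Real.exp (E / 2) := by nlinarith
    nlinarith
  · have h3 := h2 (Real.exp (x n + L n)) (hxn.trans (Real.exp_le_exp.2 (by linarith))) (w - L n)
      (by linarith)
    rw [← Real.exp_add, add_assoc, add_sub_cancel] at h3
    have h4 : Real.exp ((ρ + 1 / 2) * (w - L n)) ≤ Real.exp (E / 2) := by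
      refine Real.exp_le_exp.2 ?_
      have h5 : 0 ≤ w - L n := by linarith
      have h6 : w - L n ≤ E := by linarith [hw.2]
      nlinarith
    have h7 := hn (L n) ⟨hLn, le_rfl⟩
    calc |A (Real.exp (x n + w))|
        ≤ C₂ * Real.exp ((ρ + 1 / 2) * (w - L n)) * |A (Real.exp (x n + L n))| := h3
      _ ≤ C₂ * Real.exp (E / 2) * (C₁ * |A (Real.exp (x n))|) := by gcongr
      _ ≤ C₁ * (1 + C₂) * Real.exp (E / 2) * |A (Real.exp (x n))| := by
        have : 0 ≤ C₁ * Real.exp (E / 2) * |A (Real.exp (x n))| := by positivity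
        linarith

/-- The condition γ > -1/2 enters here: it gives e^{-γE} ≤ e^{E/2}. The polynomial factors in E are
absorbed by the same exponential. -/
lemma exists_locationWeight_le {γ : ℝ} (hγ : -(1 / 2) < γ) :
    ∃ C : ℝ, 0 < C ∧ ∀ L E : ℝ, 0 ≤ L → 0 ≤ E →
      locationWeight γ (L + E) ≤ C * (1 + rateWeight γ (Real.exp L)) * Real.exp (E / 2) := by
  have hE4 : ∀ E : ℝ, 0 ≤ E → 1 + E ≤ 4 * Real.exp (E / 4) := fun E hE => by
    linarith [Real.add_one_le_exp (E / 4)]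
  have hE2 : ∀ E : ℝ, 0 ≤ E → 1 + E ≤ 2 * Real.exp (E / 2) := fun E hE => by
    linarith [Real.add_one_le_exp (E / 2)]
  have hprod : ∀ L E : ℝ, 0 ≤ L → 0 ≤ E → 1 + (L + E) ≤ (1 + L) * (1 + E) := fun L E hL hE => by
    nlinarith
  rcases lt_trichotomy γ 0 with h | h | h
  · refine ⟨2 * (1 + 1 / -γ) + 1, by have : 0 < -γ := by linarith
                                     positivity, fun L E hL hE => ?_⟩
    have hγ0 : 0 < -γ := by linarith
    rw [locationWeight, if_neg h.le.not_gt, if_neg h.ne, rateWeight, if_neg h.le.not_gt,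
      if_neg h.ne, ← Real.exp_mul, mul_comm L]
    set e := Real.exp (-γ * L) with he
    have he1 : 1 ≤ e := Real.one_le_exp (mul_nonneg hγ0.le hL)
    have hL1 : 1 + L ≤ (1 + 1 / -γ) * e := by
      have h1 : -γ * L ≤ e := by linarith [Real.add_one_le_exp (-γ * L)]
      have h2 : L ≤ 1 / -γ * e := by
        rw [div_mul_eq_mul_div, one_mul, le_div_iff₀ hγ0]; linarith
      linarith
    have h3 : Real.exp (-γ * (L + E)) ≤ e * Real.exp (E / 2) := by
      rw [he, ← Real.exp_add]
      refine Real.exp_le_exp.2 ?_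
      nlinarith
    have h4 : 1 + (L + E) ≤ (1 + 1 / -γ) * e * (2 * Real.exp (E / 2)) := by
      refine (hprod L E hL hE).trans ?_
      have := hE2 E hE
      gcongr
    have h5 : 0 < 1 / -γ := by positivity
    have h6 := Real.exp_pos (E / 2)
    calc 1 + (L + E) + Real.exp (-γ * (L + E))
        ≤ (1 + 1 / -γ) * e * (2 * Real.exp (E / 2)) + e * Real.exp (E / 2) := add_le_add h4 h3
      _ = (2 * (1 + 1 / -γ) + 1) * e * Real.exp (E / 2) := by ring
      _ ≤ _ := by gcongr; linarith
  · subst h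
    refine ⟨32, by norm_num, fun L E hL hE => ?_⟩
    simp only [locationWeight, rateWeight, lt_irrefl, if_false, if_true, Real.log_exp]
    have h1 := hprod L E hL hE
    have h2 := hE4 E hE
    have h3 : (1 + L) ^ 2 ≤ 2 * (1 + L ^ 2) := by nlinarith [sq_nonneg (L - 1)]
    have h4 : Real.exp (E / 4) ^ 2 = Real.exp (E / 2) := by
      rw [← Real.exp_nat_mul]; congr 1; push_cast; ring
    calc (1 + (L + E)) ^ 2 ≤ ((1 + L) * (4 * Real.exp (E / 4))) ^ 2 := by
          gcongr
          exact h1.trans (by gcongr)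
      _ = (1 + L) ^ 2 * (16 * Real.exp (E / 4) ^ 2) := by ring
      _ ≤ 2 * (1 + L ^ 2) * (16 * Real.exp (E / 4) ^ 2) := by gcongr
      _ = 32 * (1 + L ^ 2) * Real.exp (E / 2) := by rw [h4]; ring
  · refine ⟨2, by norm_num, fun L E hL hE => ?_⟩
    simp only [locationWeight, rateWeight, h, if_true, Real.log_exp]
    refine (hprod L E hL hE).trans ?_
    have := hE2 E hE
    calc (1 + L) * (1 + E) ≤ (1 + L) * (2 * Real.exp (E / 2)) := by gcongr
      _ = _ := by ring

/-! ### The deterministic bound -/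

/-- On the event that the estimators and the threshold are within `Δ` of their targets, the
predictive law is close to the conditional law of the exceedances, uniformly over regions. -/
lemma exists_abs_cond_sub_predictive_le (γ : ℝ) :
    ∃ c₀ C₀ : ℝ, 0 < c₀ ∧ 0 < C₀ ∧ ∀ (μ : Measure ℝ) (Q A : ℝ → ℝ) (x₁ x L E Δ c σ u τ : ℝ)
      (B : Set ℝ), IsProbabilityMeasure μ → Q = (quantile fun x => cdf μ x) →
      RegularTail Q A γ x₁ → x₁ ≤ x → 0 ≤ L → 0 ≤ E → 0 ≤ Δ →
      Δ * locationWeight γ (L + E) ≤ c₀ →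
      (∀ w ∈ Set.Icc 0 (L + E), |A (Real.exp (x + w))| ≤ Δ) → |c - γ| ≤ Δ → 0 < σ →
      |Real.log (tailSlope Q x) - Real.log σ| ≤ Δ → |tailQuantile Q x - u| ≤ Δ * σ →
      0 < τ → L = -Real.log τ → MeasurableSet B →
      IntegrableOn (predictiveDensity c σ u τ) B →
      |(μ[|Set.Ioi (tailQuantile Q (x + L))]).real B - ∫ y in B, predictiveDensity c σ u τ y|
        ≤ C₀ * (Δ * locationWeight γ (L + E)) + Real.exp (-E) := by
  obtain ⟨c₁, C₁, hc₁, hC₁, hmain⟩ := exists_le_predictiveDensity_mul γ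
  refine ⟨min c₁ (1 / (2 * C₁)), 3 * C₁, by positivity, by positivity, ?_⟩
  intro μ Q A x₁ x L E Δ c σ u τ B hμ hQ h hx hL hE hΔ hΔW hA hc hσ hlog hu hτ hLτ hB hint
  set W := locationWeight γ (L + E) with hW
  have hW0 : 0 ≤ W := by
    have := one_add_le_locationWeight (γ := γ) (add_nonneg hL hE)
    linarith
  have hθ1 : C₁ * (Δ * W) ≤ 1 / 2 := by
    have := hΔW.trans (min_le_right _ _)
    rw [le_div_iff₀ (by positivity)] at this
    linarith
  have hθ0 : 0 ≤ C₁ * (Δ * W) := by positivity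
  have hxv : ∀ v, 0 ≤ v → x₁ ≤ x + v := fun v hv => by linarith
  have hlogv := abs_sub_sub_mul_le (f := fun v => Real.log (tailSlope Q (x + v)))
    (B := fun v => A (Real.exp (x + v))) (γ := γ) (V := L + E)
    (fun v hv => (h.hasDerivAt_log (x + v) (hxv v hv.1)).comp_const_add x v) hA
  simp only [add_zero] at hlogv
  have hdens := hmain c Δ (L + E) σ u τ (fun v => tailQuantile Q (x + v))
    (fun v => tailSlope Q (x + v)) hΔ (add_nonneg hL hE) (hΔW.trans (min_le_left _ _)) hc hσ hτ
    (by simpa using hu) (fun v hv => (h.hasDerivAt (x + v) (hxv v hv.1)).comp_const_add x v)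
    (fun v hv => h.slope_pos (x + v) (hxv v hv.1))
    (fun v hv => by
      have h1 := hlogv v hv
      calc |Real.log (tailSlope Q (x + v)) - Real.log σ - γ * v|
          = |(Real.log (tailSlope Q x) - Real.log σ) + (Real.log (tailSlope Q (x + v))
              - Real.log (tailSlope Q x) - γ * v)| := by ring_nf
        _ ≤ _ := (abs_add_le _ _).trans (by linarith))
  have hπ1 : Real.exp (-(x + L)) < 1 := by
    have := h.pos
    simp only [Real.exp_lt_one_iff, neg_lt_zero]
    linarith
  -- Levels are parametrized as p = 1 - e^{-(x + v)}: the interval of levels is L + θ < v < L + E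
  -- with θ = C₁ΔW.
  have hmem : ∀ p ∈ Set.Ioo (1 - Real.exp (-(x + L)) * Real.exp (-(C₁ * (Δ * W))))
      (1 - Real.exp (-(x + L)) * Real.exp (-E)),
      ∃ v, L + C₁ * (Δ * W) < v ∧ v < L + E ∧ p = 1 - Real.exp (-(x + v)) := by
    intro p hp
    rw [← Real.exp_add, ← Real.exp_add] at hp
    have hp1 : 0 < 1 - p := by linarith [hp.2, Real.exp_pos (-(x + L) + -E)]
    have h1 : Real.log (1 - p) < -(x + L) + -(C₁ * (Δ * W)) :=
      (Real.log_lt_iff_lt_exp hp1).2 (by linarith [hp.1])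
    have h2 : -(x + L) + -E < Real.log (1 - p) :=
      (Real.lt_log_iff_exp_lt hp1).2 (by linarith [hp.2])
    refine ⟨-Real.log (1 - p) - x, by linarith, by linarith, ?_⟩
    rw [add_sub_cancel, neg_neg, Real.exp_log hp1]
    ring
  have hfin := abs_cond_sub_setIntegral_le (Q' := deriv Q) (f := predictiveDensity c σ u τ) hQ
    (Real.exp_pos (-(x + L))) hπ1 hθ0 hθ1 (Real.exp_pos (-E)).le
    (h.strictMonoOn (hxv L hL))
    (fun p hp => by
      obtain ⟨v, hv1, hv2, rfl⟩ := hmem p hp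
      exact h.hasDerivAt_quantile _ (hxv v (by linarith)))
    (fun p hp => by
      obtain ⟨v, hv1, hv2, rfl⟩ := hmem p hp
      exact h.deriv_pos (hxv v (by linarith)))
    (fun y => predictiveDensity_nonneg c u y hσ hτ) (lintegral_predictiveDensity c u hσ hτ)
    (fun p hp => by
      obtain ⟨v, hv1, hv2, rfl⟩ := hmem p hp
      have h1 := hdens v ⟨by linarith, hv2.le⟩ (by rw [← hLτ]; exact hv1)
      have h2 := Real.exp_pos (-(x + v))
      have h3 : Real.exp (-Real.log τ - v) = Real.exp (-(x + v)) / Real.exp (-(x + L)) := by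
        rw [← Real.exp_sub, hLτ]; ring_nf
      rw [h3] at h1
      refine le_of_mul_le_mul_right (le_trans (le_of_eq ?_) (h1.trans (le_of_eq ?_))) h2
      · ring
      · simp only [tailSlope, tailQuantile]
        ring)
    hB hint
  rw [tailQuantile]
  refine hfin.trans (le_of_eq ?_)
  ring

/-! ### Stochastic bound for the conditional coverage -/

lemma tendsto_log_div_atTop {k : ℕ → ℕ} (hkn : ∀ᶠ n in atTop, k n < n)
    (hk : Tendsto k atTop atTop) (hkn0 : Tendsto (fun n => (k n : ℝ) / n) atTop (𝓝 0)) :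
    Tendsto (fun n : ℕ => Real.log ((n : ℝ) / k n)) atTop atTop := by
  have h1 : Tendsto (fun n => (k n : ℝ) / n) atTop (𝓝[>] 0) := by
    refine tendsto_nhdsWithin_iff.2 ⟨hkn0, ?_⟩
    filter_upwards [hkn, hk.eventually (eventually_gt_atTop 0)] with n h1 h2
    have hkR : (0 : ℝ) < k n := Nat.cast_pos.2 h2
    have hnR : (0 : ℝ) < n := Nat.cast_pos.2 (by omega)
    exact Set.mem_Ioi.2 (div_pos hkR hnR)
  have h2 := Real.tendsto_log_atTop.comp (tendsto_inv_nhdsGT_zero.comp h1)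
  refine h2.congr fun n => ?_
  simp [Function.comp]

variable {Ω : Type*} [MeasurableSpace Ω] {P : Measure Ω} [IsProbabilityMeasure P]
  {X : ℕ → Ω → ℝ}

/-- On the event that estimators and intermediate order statistic deviate by at most a multiple of
`1 / √k` from their targets, the combined relative error is a multiple of `1 / √k`. -/
lemma parameter_errors_le {a σ slope s M₂ Mₐ : ℝ} (ha : 0 < a) (hslope : 0 < slope)
    (hσ : |σ / a - 1| ≤ M₂ * s) (haslope : |a / slope - 1| ≤ Mₐ * s)
    (hM : 2 * (M₂ * s) + Mₐ * s ≤ 1 / 2) :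
    0 < σ ∧ |Real.log slope - Real.log σ| ≤ 2 * (2 * (M₂ * s) + Mₐ * s) ∧ slope ≤ 2 * σ := by
  have h1 := abs_le.1 hσ
  have h2 := abs_le.1 haslope
  have hM2 : 0 ≤ M₂ * s := (abs_nonneg _).trans hσ
  have hMa : 0 ≤ Mₐ * s := (abs_nonneg _).trans haslope
  set q := σ / a with hq
  set p := a / slope with hp
  have hq0 : 0 < q := by linarith
  have hp0 : 0 < p := div_pos ha hslope
  have hσq : σ = q * a := by rw [hq]; field_simp
  have hσ0 : 0 < σ := hσq ▸ mul_pos hq0 ha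
  have hqp : σ / slope = q * p := by rw [hq, hp]; field_simp
  have h3 : |q * p - 1| ≤ 2 * (M₂ * s) + Mₐ * s := by
    have h4 : q * p - 1 = (q - 1) * p + (p - 1) := by ring
    rw [h4]
    refine (abs_add_le _ _).trans (add_le_add ?_ haslope)
    rw [abs_mul, abs_of_pos hp0]
    calc |q - 1| * p ≤ (M₂ * s) * 2 := mul_le_mul hσ (by linarith) hp0.le hM2
      _ = _ := by ring
  have h5 : |q * p - 1| ≤ 1 / 2 := h3.trans hM
  refine ⟨hσ0, ?_, ?_⟩
  · rw [abs_sub_comm, ← Real.log_div hσ0.ne' hslope.ne', hqp]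
    have h6 := abs_log_one_add_le h5
    rw [add_sub_cancel] at h6
    linarith
  · have h6 := (abs_le.1 h5).1
    have h7 : 1 / 2 ≤ σ / slope := by rw [hqp]; linarith
    rw [le_div_iff₀ hslope] at h7
    linarith

/-- The bound of `exists_abs_cond_sub_predictive_le` for errors of order `s`, in terms of a
sequence `r` dominating `s` times the rate weight. -/
lemma exists_abs_cond_sub_predictive_le_sqrt {γ : ℝ} (hγ : -(1 / 2) < γ) :
    ∃ c₀ C₀ : ℝ, 0 < c₀ ∧ 0 < C₀ ∧ ∀ (μ : Measure ℝ) (Q A : ℝ → ℝ)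
      (x₁ x L s r D b c σ u τ : ℝ) (B : Set ℝ), IsProbabilityMeasure μ →
      Q = (quantile fun x => cdf μ x) → RegularTail Q A γ x₁ → x₁ ≤ x → 0 ≤ L → 0 < τ →
      L = -Real.log τ → 0 < s → 0 < D → 0 < r → √r < 1 →
      (1 + rateWeight γ (1 / τ)) * s ≤ b * r → D * b * √r ≤ c₀ →
      (∀ E, 0 ≤ E → ∀ w ∈ Set.Icc 0 (L + E), |A (Real.exp (x + w))| ≤ D * s * Real.exp (E / 2)) →
      |c - γ| ≤ D * s → 0 < σ → |Real.log (tailSlope Q x) - Real.log σ| ≤ D * s →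
      |tailQuantile Q x - u| ≤ D * s * σ → MeasurableSet B →
      IntegrableOn (predictiveDensity c σ u τ) B →
      |(μ[|Set.Ioi (tailQuantile Q (x + L))]).real B - ∫ y in B, predictiveDensity c σ u τ y|
        ≤ (C₀ * (D * b) + 1) * √r := by
  obtain ⟨Cw, hCw, hweight⟩ := exists_locationWeight_le hγ
  obtain ⟨c₀, C₀, hc₀, hC₀, hdet⟩ := exists_abs_cond_sub_predictive_le γ
  refine ⟨c₀ / Cw, C₀ * Cw, by positivity, by positivity, ?_⟩
  intro μ Q A x₁ x L s r D b c σ u τ B hμ hQ h hx hL hτ hLτ hs hD hr hr1 hrb hsmall hA hc hσ hlog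
    hu hB hint
  rw [le_div_iff₀ hCw] at hsmall
  -- The discarded tail then has mass e^{-E} = √r. The two factors e^{E/2}, from A and from the
  -- weight, multiply to r^{-1/2} and turn the bound b r into b √r.
  set E := -Real.log √r with hE
  have hsr : 0 < √r := Real.sqrt_pos.2 hr
  have hE0 : 0 ≤ E := neg_nonneg.2 (Real.log_nonpos hsr.le hr1.le)
  have heE : Real.exp (-E) = √r := by rw [hE, neg_neg, Real.exp_log hsr]
  have heE1 : 1 ≤ Real.exp (E / 2) := Real.one_le_exp (by positivity)
  have heL : Real.exp L = 1 / τ := by rw [hLτ, Real.exp_neg, Real.exp_log hτ, one_div]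
  set Δ := D * s * Real.exp (E / 2) with hΔ
  have hΔge : D * s ≤ Δ := le_mul_of_one_le_right (by positivity) heE1
  have hΔW : Δ * locationWeight γ (L + E) ≤ Cw * (D * b * √r) := by
    have h1 := hweight L E hL hE0
    rw [heL] at h1
    have h2 : Real.exp (E / 2) * Real.exp (E / 2) * r = √r := by
      have h4 : Real.exp (E / 2) * Real.exp (E / 2) * √r = 1 := by
        rw [← heE, ← Real.exp_add, ← Real.exp_add]
        simp
      calc _ = Real.exp (E / 2) * Real.exp (E / 2) * (√r * √r) := by
            rw [Real.mul_self_sqrt hr.le]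
        _ = _ := by rw [← mul_assoc, h4, one_mul]
    calc Δ * locationWeight γ (L + E)
        ≤ D * s * Real.exp (E / 2) * (Cw * (1 + rateWeight γ (1 / τ)) * Real.exp (E / 2)) := by
          gcongr
      _ = D * Cw * (Real.exp (E / 2) * Real.exp (E / 2)) * ((1 + rateWeight γ (1 / τ)) * s) := by
          ring
      _ ≤ D * Cw * (Real.exp (E / 2) * Real.exp (E / 2)) * (b * r) := by gcongr
      _ = Cw * (D * b * (Real.exp (E / 2) * Real.exp (E / 2) * r)) := by ring
      _ = _ := by rw [h2]
  have hmain := hdet μ Q A x₁ x L E Δ c σ u τ B hμ hQ h hx hL hE0 (by positivity)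
    (hΔW.trans (by linarith)) (hA E hE0) (hc.trans hΔge) hσ (hlog.trans hΔge)
    (hu.trans (mul_le_mul_of_nonneg_right hΔge hσ.le)) hτ hLτ hB hint
  rw [heE] at hmain
  have h1 := mul_le_mul_of_nonneg_left hΔW hC₀.le
  linarith

set_option maxHeartbeats 400000 in
/-- The conditional coverage deviates from the nominal coverage by at most the order of `√r`, for
every null sequence `r` dominating `(1 + w) / √k`. -/
theorem isBigOInProbability_conditionalCoverage
    (hXmeas : ∀ i, Measurable (X i)) (hXindep : iIndepFun X P)
    (hXident : ∀ i, IdentDistrib (X i) (X 0) P P)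
    {Q a A : ℝ → ℝ} (hQ : Q = quantile fun x => cdf (P.map (X 0)) x) {γ ρ : ℝ}
    (hγ : -(1 / 2) < γ)
    (hSO : VonMisesSecondOrder (fun x => cdf (P.map (X 0)) x) a γ ρ) (hA : A = vonMisesRate Q γ)
    {k : ℕ → ℕ} (hkn : ∀ᶠ n in atTop, k n < n) (hk : Tendsto k atTop atTop)
    (hkn0 : Tendsto (fun n => (k n : ℝ) / n) atTop (𝓝 0))
    {ν τ : ℕ → ℝ} (hν : ∀ᶠ n in atTop, 0 < ν n ∧ ν n ≤ k n)
    (hτ : τ = fun n => tailRatio n (k n) (ν n)) {τ₀ : ℝ} (hτ₀ : Tendsto τ atTop (𝓝 τ₀))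
    (hAmono : ρ = 0 → τ₀ = 0 → ∃ t₀ : ℝ, AntitoneOn (fun t => |A t|) (Set.Ici t₀))
    {T₁ T₂ : ∀ n : ℕ, (Fin (k n + 1) → ℝ) → ℝ}
    (hγhat : IsBigOInProbability P
      (fun n ω => T₁ n (topOrderStats (k n) (sample X n ω)) - γ) (fun n => 1 / √(k n : ℝ)))
    (hσhat : IsBigOInProbability P
      (fun n ω => T₂ n (topOrderStats (k n) (sample X n ω)) / a (n / k n) - 1)
      (fun n => 1 / √(k n : ℝ)))
    {l : ℝ} (hl : 0 < l) (hbal : Tendsto (fun n : ℕ => √(k n : ℝ) * |A (n / k n)|) atTop (𝓝 l))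
    {α : ℝ} (hα : α ∈ Set.Ioo (0 : ℝ) 1) {R : ∀ n : ℕ, (Fin n → ℝ) → Set ℝ}
    (hRmeas : ∀ n, MeasurableSet {p : (Fin n → ℝ) × ℝ | p.2 ∈ R n p.1})
    (hR : ∀ᶠ n in atTop, ∀ᵐ ω ∂P,
      ∫ y in R n (sample X n ω),
        freqPredictiveDensity (k n) (T₁ n) (T₂ n) (τ n) (sample X n ω) y = 1 - α)
    {r : ℕ → ℝ} (hr0 : ∀ᶠ n in atTop, 0 < r n) (hr : Tendsto r atTop (𝓝 0)) {b : ℝ} (hb : 0 < b)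
    (hrb : ∀ᶠ n in atTop, (1 + rateWeight γ (1 / τ n)) / √(k n : ℝ) ≤ b * r n) :
    IsBigOInProbability P
      (fun n ω => conditionalCoverage P X n (Q (level n (ν n))) (R n) ω - (1 - α))
      (fun n => √(r n)) := by
  have hμ := Measure.isProbabilityMeasure_map (μ := P) (hXmeas 0).aemeasurable
  obtain ⟨x₁, hreg⟩ := hSO.exists_regularTail hQ
  rw [← hA] at hreg
  have hSO2 := hSO.2.2
  rw [← hQ, ← hA] at hSO2
  have hAm : Measurable A := hA ▸ measurable_vonMisesRate Q γ
  obtain ⟨Cₐ, xₐ, hCₐ, hscale⟩ := hSO2.exists_abs_div_sub_one_le hAm hreg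
  obtain ⟨-, hA0, hρ, hRV, -⟩ := hSO2
  obtain ⟨Cₒ, xₒ, hCₒ, horder⟩ :=
    exists_measure_lt_abs_orderStat_sub_le hXmeas hXindep hXident hQ hreg hA0
  obtain ⟨c₀, C₀, hc₀, hC₀, hdet⟩ := exists_abs_cond_sub_predictive_le_sqrt hγ
  set x : ℕ → ℝ := fun n => Real.log ((n : ℝ) / k n) with hx
  set L : ℕ → ℝ := fun n => -Real.log (τ n) with hL
  have hxt : Tendsto x atTop atTop := tendsto_log_div_atTop hkn hk hkn0
  have hbasic : ∀ᶠ n in atTop, 0 < k n ∧ k n < n ∧ 0 < τ n ∧ 0 ≤ L n ∧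
      Real.exp (x n) = n / k n ∧ Real.exp (-x n) = k n / n ∧ Real.exp (L n) = 1 / τ n ∧
      Q (level n (ν n)) = tailQuantile Q (x n + L n) := by
    filter_upwards [hkn, hk.eventually (eventually_gt_atTop 0), hν] with n h1 h2 h3
    have hkR : (0 : ℝ) < k n := Nat.cast_pos.2 h2
    have hnR : (0 : ℝ) < n := Nat.cast_pos.2 (by omega)
    have hτn : τ n = ν n / k n := by
      rw [hτ]
      simp only [tailRatio, level, sub_sub_cancel]
      field_simp
    have hτpos : 0 < τ n := hτn ▸ div_pos h3.1 hkR
    have hτ1 : τ n ≤ 1 := by rw [hτn, div_le_one hkR]; exact h3.2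
    have he : Real.exp (x n) = n / k n := Real.exp_log (div_pos hnR hkR)
    have heL : Real.exp (L n) = 1 / τ n := by
      rw [hL, Real.exp_neg, Real.exp_log hτpos, one_div]
    refine ⟨h2, h1, hτpos, neg_nonneg.2 (Real.log_nonpos hτpos.le hτ1), he, ?_, heL, ?_⟩
    · rw [Real.exp_neg, he, inv_div]
    · rw [tailQuantile, neg_add, Real.exp_add, Real.exp_neg, Real.exp_neg, he, heL, level, hτn]
      congr 2
      field_simp
  have hLmono : ρ = 0 → (∃ B, ∀ᶠ n in atTop, L n ≤ B) ∨
      ∃ t₀ : ℝ, AntitoneOn (fun t => |A t|) (Set.Ici t₀) := by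
    intro h0
    -- If τ₀ ≠ 0 then L converges to -log τ₀, hence is bounded, and monotonicity of |A| is not
    -- needed.
    by_cases hτ0 : τ₀ = 0
    · exact Or.inr (hAmono h0 hτ0)
    · refine Or.inl ⟨-Real.log τ₀ + 1, ?_⟩
      exact ((hτ₀.log hτ0).neg.eventually (gt_mem_nhds (lt_add_one _))).mono fun n hn => hn.le
  obtain ⟨C_A, hC_A, hAbound⟩ := hRV.exists_eventually_abs_le hAm hρ hxt
    (hbasic.mono fun n hn => hn.2.2.2.1) hLmono
  have hsk : Tendsto (fun n => √(k n : ℝ)) atTop atTop :=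
    Real.tendsto_sqrt_atTop.comp (tendsto_natCast_atTop_atTop.comp hk)
  have hs0 : Tendsto (fun n => 1 / √(k n : ℝ)) atTop (𝓝 0) := by
    simpa only [one_div] using! hsk.inv_tendsto_atTop
  have hsqrtr : Tendsto (fun n => √(r n)) atTop (𝓝 0) := by
    simpa using hr.sqrt
  intro ζ hζ
  obtain ⟨M₁, hM₁, hM₁e⟩ := hγhat (ζ / 3) (by positivity)
  obtain ⟨M₂, hM₂, hM₂e⟩ := hσhat (ζ / 3) (by positivity)
  -- Chosen so that 8 / (k (b₀/√k)²) = ζ/3, the share of the error probability left for the order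
  -- statistic.
  set b₀ := √(24 / ζ) with hb₀
  have hb₀0 : 0 < b₀ := Real.sqrt_pos.2 (by positivity)
  have hb₀2 : b₀ ^ 2 = 24 / ζ := Real.sq_sqrt (by positivity)
  set Mₐ := 2 * Cₐ * l with hMₐ
  set M₃ := 2 * (2 * M₂ + Mₐ) with hM₃
  -- In units of 1/√k the summands bound the errors of the index, the log-scale, the threshold and
  -- the rate function, in this order.
  set D := M₁ + M₃ + 2 * Cₒ * b₀ + 2 * C_A * l with hD
  have hD0 : 0 < D := by positivity
  refine ⟨C₀ * (D * b) + 1, by positivity, ?_⟩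
  have hsmall : ∀ᶠ n in atTop, b₀ * (1 / √(k n : ℝ)) ≤ 1 ∧ M₂ * (1 / √(k n : ℝ)) ≤ 1 / 2 ∧
      2 * (M₂ * (1 / √(k n : ℝ))) + Mₐ * (1 / √(k n : ℝ)) ≤ 1 / 2 ∧ √(r n) < 1 ∧
      D * b * √(r n) ≤ c₀ := by
    have h1 : Tendsto (fun n => b₀ * (1 / √(k n : ℝ))) atTop (𝓝 (b₀ * 0)) := hs0.const_mul b₀
    have h2 : Tendsto (fun n => M₂ * (1 / √(k n : ℝ))) atTop (𝓝 (M₂ * 0)) := hs0.const_mul M₂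
    have h3 := (h2.const_mul 2).add (hs0.const_mul Mₐ)
    have h4 := hsqrtr.const_mul (D * b)
    rw [mul_zero] at h1 h2 h4
    simp only [mul_zero, add_zero] at h3
    filter_upwards [h1.eventually (gt_mem_nhds one_pos),
      h2.eventually (gt_mem_nhds (show (0 : ℝ) < 1 / 2 by norm_num)),
      h3.eventually (gt_mem_nhds (show (0 : ℝ) < 1 / 2 by norm_num)),
      hsqrtr.eventually (gt_mem_nhds one_pos), h4.eventually (gt_mem_nhds hc₀)]
      with n a1 a2 a3 a4 a5
    exact ⟨a1.le, a2.le, a3.le, a4, a5.le⟩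
  filter_upwards [hbasic, hsmall, hM₁e, hM₂e, hAbound, hr0, hrb, hR,
    hxt.eventually (eventually_ge_atTop x₁), hxt.eventually (eventually_ge_atTop xₐ),
    hxt.eventually (eventually_ge_atTop xₒ),
    hbal.eventually (gt_mem_nhds (show l < 2 * l by linarith))]
    with n hbas hsm hm1 hm2 hAb hrpos hrbn hRn hxn1 hxna hxno hbaln
  obtain ⟨hkpos, hkltn, hτpos, hLn, hex, hexn, heL, hlev⟩ := hbas
  obtain ⟨hs1, hs2, hs3, hr1, hrc⟩ := hsm
  have hkR : (0 : ℝ) < k n := Nat.cast_pos.2 hkpos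
  have hskpos : 0 < √(k n : ℝ) := Real.sqrt_pos.2 hkR
  set s := 1 / √(k n : ℝ) with hs
  have hspos : 0 < s := by positivity
  obtain ⟨hapos, hascale⟩ := hscale (x n) hxna
  have hAs : |A (Real.exp (x n))| ≤ 2 * l * s := by
    rw [hex, hs, mul_one_div, le_div_iff₀ hskpos, mul_comm]
    exact hbaln.le
  have haslope : |a (Real.exp (x n)) / tailSlope Q (x n) - 1| ≤ Mₐ * s :=
    hascale.trans ((mul_le_mul_of_nonneg_left hAs hCₐ.le).trans (le_of_eq (by rw [hMₐ]; ring)))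
  have hslope := hreg.slope_pos (x n) hxn1
  have hm3 := horder n (k n) (x n) (b₀ * s) hkpos hkltn hxno hexn (by positivity) hs1
  have hζ3 : 8 / ((k n : ℝ) * (b₀ * s) ^ 2) = ζ / 3 := by
    rw [mul_pow, hb₀2, hs, div_pow, Real.sq_sqrt hkR.le]
    field_simp
    norm_num
  rw [hζ3] at hm3
  have hidn : P.map (X n) = P.map (X 0) := (hXident n).map_eq
  have hPt : P (X n ⁻¹' Set.Ioi (Q (level n (ν n)))) ≠ 0 := by
    rw [← Measure.map_apply (hXmeas n) measurableSet_Ioi, hidn, hlev,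
      hreg.measure_Ioi_tailQuantile hQ (by linarith)]
    simpa using Real.exp_pos _
  have hcov := conditionalCoverage_ae_eq hXmeas hXindep n hPt (hRmeas n)
  rw [hidn] at hcov
  set bad₁ := {ω | M₁ * s < |T₁ n (topOrderStats (k n) (sample X n ω)) - γ|} with hbad₁
  set bad₂ := {ω | M₂ * s < |T₂ n (topOrderStats (k n) (sample X n ω)) / a (n / k n) - 1|}
    with hbad₂
  set bad₃ := {ω | Cₒ * tailSlope Q (x n) * (b₀ * s)
    < |orderStat (sample X n ω) (n - k n) - tailQuantile Q (x n)|} with hbad₃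
  have hbound : P {ω | (C₀ * (D * b) + 1) * √(r n)
      < |conditionalCoverage P X n (Q (level n (ν n))) (R n) ω - (1 - α)|}
      ≤ P (bad₁ ∪ bad₂ ∪ bad₃) := by
    refine measure_mono_ae ?_
    filter_upwards [hcov, hRn] with ω hω hRω hlt
    by_contra hnot
    have hgood : ω ∉ bad₁ ∪ bad₂ ∪ bad₃ := hnot
    simp only [Set.mem_union, not_or, hbad₁, hbad₂, hbad₃, Set.mem_ofPred_eq, not_lt] at hgood
    obtain ⟨⟨hg1, hg2⟩, hg3⟩ := hgood
    rw [← hex] at hg2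
    obtain ⟨hσ, hlogσ, hslopeσ⟩ := parameter_errors_le hapos hslope hg2
      haslope hs3
    have hM₃0 : 0 ≤ M₃ := by positivity
    have hCo0 : 0 ≤ 2 * Cₒ * b₀ := by positivity
    have hCA0 : 0 ≤ 2 * C_A * l := by positivity
    have hDge : ∀ m, m ≤ D → m * s ≤ D * s := fun m hm => mul_le_mul_of_nonneg_right hm hspos.le
    have hRm : MeasurableSet (R n (sample X n ω)) := measurable_prodMk_left (hRmeas n)
    have hint : IntegrableOn (predictiveDensity (T₁ n (topOrderStats (k n) (sample X n ω)))
        (T₂ n (topOrderStats (k n) (sample X n ω))) (orderStat (sample X n ω) (n - k n)) (τ n))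
        (R n (sample X n ω)) := by
      -- The integral of a non-integrable function is 0 by convention, which differs from 1 - α.
      by_contra hni
      have h1 := integral_undef hni
      have h2 : (1 : ℝ) - α = 0 := hRω.symm.trans h1
      linarith [hα.2]
    have hmain := hdet (P.map (X 0)) Q A x₁ (x n) (L n) s (r n) D b
      (T₁ n (topOrderStats (k n) (sample X n ω))) (T₂ n (topOrderStats (k n) (sample X n ω)))
      (orderStat (sample X n ω) (n - k n)) (τ n) (R n (sample X n ω)) hμ hQ hreg hxn1 hLn
      hτpos rfl hspos hD0 hrpos hr1 (by rw [hs, mul_one_div]; exact hrbn) hrc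
      (fun E hE0 w hw => by
        refine (hAb E hE0 w hw).trans ?_
        calc C_A * Real.exp (E / 2) * |A (Real.exp (x n))|
            ≤ C_A * Real.exp (E / 2) * (2 * l * s) := by gcongr
          _ = 2 * C_A * l * s * Real.exp (E / 2) := by ring
          _ ≤ _ := mul_le_mul_of_nonneg_right (hDge _ (by linarith)) (Real.exp_pos _).le)
      (hg1.trans (hDge _ (by linarith))) hσ
      (hlogσ.trans (by
        refine le_trans (le_of_eq ?_) (hDge M₃ (by linarith))
        rw [hM₃]; ring))
      (by
        rw [abs_sub_comm]
        refine hg3.trans ?_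
        calc Cₒ * tailSlope Q (x n) * (b₀ * s)
            ≤ Cₒ * (2 * T₂ n (topOrderStats (k n) (sample X n ω))) * (b₀ * s) := by gcongr
          _ = 2 * Cₒ * b₀ * s * T₂ n (topOrderStats (k n) (sample X n ω)) := by ring
          _ ≤ _ := mul_le_mul_of_nonneg_right (hDge _ (by linarith)) hσ.le)
      hRm hint
    have hRω' : ∫ y in R n (sample X n ω),
        predictiveDensity (T₁ n (topOrderStats (k n) (sample X n ω)))
        (T₂ n (topOrderStats (k n) (sample X n ω))) (orderStat (sample X n ω) (n - k n)) (τ n) y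
        = 1 - α := hRω
    rw [hRω'] at hmain
    have hlt' : (C₀ * (D * b) + 1) * √(r n)
      < |conditionalCoverage P X n (Q (level n (ν n))) (R n) ω - (1 - α)| := hlt
    rw [hω, hlev] at hlt'
    exact absurd hmain (not_le.2 hlt')
  refine hbound.trans ((measure_union_le _ _).trans ((add_le_add (measure_union_le _ _)
    le_rfl).trans ((add_le_add (add_le_add hm1 hm2) hm3).trans ?_)))
  rw [← ENNReal.ofReal_add (by positivity) (by positivity),
    ← ENNReal.ofReal_add (by positivity) (by positivity)]
  exact ENNReal.ofReal_le_ofReal (by linarith)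

/-! ### Choice of the rate sequence and the three conclusions -/

lemma IsBigOInProbability.tendstoInMeasure {Ω : Type*} [MeasurableSpace Ω] {P : Measure Ω}
    {C : ℕ → Ω → ℝ} {c : ℝ} {r : ℕ → ℝ} (h : IsBigOInProbability P (fun n ω => C n ω - c) r)
    (hr : Tendsto r atTop (𝓝 0)) : TendstoInMeasure P C atTop fun _ => c := by
  rw [tendstoInMeasure_iff_dist]
  intro δ hδ
  rw [ENNReal.tendsto_nhds_zero]
  intro ζ hζ
  obtain ⟨η, hη, hηζ⟩ : ∃ η : ℝ, 0 < η ∧ ENNReal.ofReal η ≤ ζ := by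
    rcases eq_or_ne ζ ⊤ with rfl | hne
    · exact ⟨1, one_pos, le_top⟩
    · exact ⟨ζ.toReal, ENNReal.toReal_pos hζ.ne' hne, (ENNReal.ofReal_toReal hne).le⟩
  obtain ⟨M, -, hMe⟩ := h η hη
  have h1 := hr.const_mul M
  rw [mul_zero] at h1
  filter_upwards [hMe, h1.eventually (gt_mem_nhds hδ)] with n hn hlt
  refine le_trans (measure_mono fun ω hω => ?_) (hn.trans hηζ)
  exact lt_of_lt_of_le hlt hω

lemma rateWeight_nonneg (γ : ℝ) {x : ℝ} (hx : 1 ≤ x) : 0 ≤ rateWeight γ x := by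
  unfold rateWeight
  split_ifs
  · exact Real.log_nonneg hx
  · positivity
  · exact Real.rpow_nonneg (zero_le_one.trans hx) _

/-- The rate weight is bounded below, away from `1` or for negative tail index. -/
lemma exists_le_rateWeight {γ : ℝ} {τ : ℕ → ℝ} {τ₀ : ℝ} (hτ : ∀ᶠ n in atTop, 0 < τ n ∧ τ n ≤ 1)
    (hτ₀ : Tendsto τ atTop (𝓝 τ₀)) (h : γ < 0 ∨ τ₀ < 1) :
    ∃ c : ℝ, 0 < c ∧ ∀ᶠ n in atTop, c ≤ rateWeight γ (1 / τ n) := by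
  rcases lt_or_ge γ 0 with hγ | hγ
  · refine ⟨1, one_pos, hτ.mono fun n hn => ?_⟩
    rw [rateWeight, if_neg hγ.le.not_gt, if_neg hγ.ne]
    exact Real.one_le_rpow ((one_le_div hn.1).2 hn.2) (by linarith)
  · have hlt : τ₀ < 1 := h.resolve_left hγ.not_gt
    have hτ₀0 : 0 ≤ τ₀ := ge_of_tendsto hτ₀ (hτ.mono fun n hn => hn.1.le)
    set d := -Real.log ((1 + τ₀) / 2) with hd
    have hd0 : 0 < d := neg_pos.2 (Real.log_neg (by linarith) (by linarith))
    refine ⟨min d (d ^ 2), by positivity, ?_⟩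
    filter_upwards [hτ, hτ₀.eventually (gt_mem_nhds (show τ₀ < (1 + τ₀) / 2 by linarith))]
      with n hn hn2
    have hlog : d ≤ Real.log (1 / τ n) := by
      rw [one_div, Real.log_inv, hd, neg_le_neg_iff]
      exact Real.log_le_log hn.1 hn2.le
    rcases hγ.lt_or_eq with h0 | h0
    · rw [rateWeight, if_pos h0]
      exact (min_le_left _ _).trans hlog
    · rw [rateWeight, if_neg h0.not_lt, if_pos h0.symm]
      refine (min_le_right _ _).trans ?_
      gcongr

end TailPrediction

theorem mainTheorem4 {Ω : Type*} [MeasurableSpace Ω] (P : Measure Ω) [IsProbabilityMeasure P]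
    -- an iid sequence with distribution function `F` and quantile function `Q`
    (X : ℕ → Ω → ℝ) (hXmeas : ∀ i, Measurable (X i)) (hXindep : iIndepFun X P)
    (hXident : ∀ i, IdentDistrib (X i) (X 0) P P)
    (F Q : ℝ → ℝ) (hF : F = fun x => cdf (P.map (X 0)) x) (hQ : Q = TailPrediction.quantile F)
    -- the second-order condition, with scaling function `a` and rate function `A`
    (a A : ℝ → ℝ) (γ ρ : ℝ) (hγ : -(1 / 2) < γ)
    (hSO : TailPrediction.VonMisesSecondOrder F a γ ρ)
    (hA : A = TailPrediction.vonMisesRate Q γ)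
    -- effective sample size, extreme level and tail ratio
    (k : ℕ → ℕ) (hkn : ∀ᶠ n in atTop, k n < n) (hk : Tendsto k atTop atTop)
    (hkn0 : Tendsto (fun n => (k n : ℝ) / n) atTop (𝓝 0))
    (ν : ℕ → ℝ) (hν : ∀ᶠ n in atTop, 0 < ν n ∧ ν n ≤ k n)
    (τ : ℕ → ℝ) (hτ : τ = fun n => TailPrediction.tailRatio n (k n) (ν n))
    (τ₀ : ℝ) (hτ₀ : Tendsto τ atTop (𝓝 τ₀))
    (hAmono : ρ = 0 → τ₀ = 0 → ∃ t₀ : ℝ, AntitoneOn (fun t => |A t|) (Set.Ici t₀))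
    (hAw : Tendsto (fun n : ℕ => A (n / k n) * TailPrediction.rateWeight γ (1 / τ n)) atTop (𝓝 0))
    -- the estimators of the tail index and of the scale
    (T₁ T₂ : ∀ n : ℕ, (Fin (k n + 1) → ℝ) → ℝ)
    (hT₁ : ∀ n, Measurable (T₁ n)) (hT₂ : ∀ n, Measurable (T₂ n))
    (hγhat : TailPrediction.IsBigOInProbability P
      (fun n ω => T₁ n (TailPrediction.topOrderStats (k n) (TailPrediction.sample X n ω)) - γ)
      (fun n => 1 / √(k n : ℝ)))
    (hσhat : TailPrediction.IsBigOInProbability P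
      (fun n ω =>
        T₂ n (TailPrediction.topOrderStats (k n) (TailPrediction.sample X n ω)) / a (n / k n) - 1)
      (fun n => 1 / √(k n : ℝ)))
    (l : ℝ) (hl : 0 < l) (hbal : Tendsto (fun n : ℕ => √(k n : ℝ) * |A (n / k n)|) atTop (𝓝 l))
    -- the data-dependent predictive regions
    (α : ℝ) (hα : α ∈ Set.Ioo (0 : ℝ) 1)
    (R : ∀ n : ℕ, (Fin n → ℝ) → Set ℝ)
    (hRmeas : ∀ n, MeasurableSet {p : (Fin n → ℝ) × ℝ | p.2 ∈ R n p.1})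
    (hR : ∀ᶠ n in atTop, ∀ᵐ ω ∂P,
      ∫ y in R n (TailPrediction.sample X n ω),
        TailPrediction.freqPredictiveDensity (k n) (T₁ n) (T₂ n) (τ n)
          (TailPrediction.sample X n ω) y = 1 - α)
    -- the rate
    (ε : ℕ → ℝ) (hεpos : ∀ᶠ n in atTop, 0 < ε n) (hε : Tendsto ε atTop (𝓝 0))
    (hkε : Tendsto (fun n => (k n : ℝ) * ε n ^ 2) atTop atTop)
    (hεw : Tendsto (fun n => ε n * TailPrediction.rateWeight γ (1 / τ n)) atTop (𝓝 0))
    -- the conditional coverage probability above the extreme threshold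
    (C : ℕ → Ω → ℝ)
    (hC : C = fun n => TailPrediction.conditionalCoverage P X n
      (Q (TailPrediction.level n (ν n))) (R n)) :
    ((γ < 0 ∨ τ₀ < 1) →
      TailPrediction.IsBigOInProbability P (fun n ω => C n ω - (1 - α))
        (fun n => √(ε n * TailPrediction.rateWeight γ (1 / τ n)))) ∧
    TailPrediction.IsBigOInProbability P (fun n ω => C n ω - (1 - α))
      (fun n => √(ε n * TailPrediction.rateWeight γ (1 / τ n) + 1 / √(k n : ℝ))) ∧
    TendstoInMeasure P C atTop (fun _ => 1 - α) := by

  subst hF hC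
  -- It remains to choose a positive null sequence r that dominates (1 + w)/√k up to a constant b.
  have hkey := fun (r : ℕ → ℝ) hr0 hr (b : ℝ) hb hrb =>
    TailPrediction.isBigOInProbability_conditionalCoverage hXmeas hXindep hXident hQ hγ hSO hA hkn hk
      hkn0 hν hτ hτ₀ hAmono hγhat hσhat hl hbal hα hRmeas hR (r := r) hr0 hr (b := b) hb hrb
  set w : ℕ → ℝ := fun n => TailPrediction.rateWeight γ (1 / τ n) with hw
  have hτ01 : ∀ᶠ n in atTop, 0 < τ n ∧ τ n ≤ 1 := by
    filter_upwards [hkn, hk.eventually (eventually_gt_atTop 0), hν] with n h1 h2 h3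
    have hkR : (0 : ℝ) < k n := Nat.cast_pos.2 h2
    have hnR : (0 : ℝ) < n := Nat.cast_pos.2 (by omega)
    have hτn : τ n = ν n / k n := by
      rw [hτ]
      simp only [TailPrediction.tailRatio, TailPrediction.level, sub_sub_cancel]
      field_simp
    rw [hτn, div_le_one hkR]
    exact ⟨div_pos h3.1 hkR, h3.2⟩
  have hw0 : ∀ᶠ n in atTop, 0 ≤ w n := hτ01.mono fun n hn =>
    TailPrediction.rateWeight_nonneg γ ((one_le_div hn.1).2 hn.2)
  have hkpos : ∀ᶠ n in atTop, (0 : ℝ) < √(k n : ℝ) :=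
    (hk.eventually (eventually_gt_atTop 0)).mono fun n hn => Real.sqrt_pos.2 (Nat.cast_pos.2 hn)
  -- Only k ε² ≥ 1 is needed: it replaces w/√k by ε w.
  have hsε : ∀ᶠ n in atTop, 1 / √(k n : ℝ) ≤ ε n := by
    filter_upwards [hkε.eventually (eventually_ge_atTop 1), hεpos, hkpos] with n h1 h2 h3
    rw [div_le_iff₀ h3]
    refine (sq_le_sq₀ zero_le_one (by positivity)).1 ?_
    rw [mul_pow, Real.sq_sqrt (Nat.cast_nonneg _)]
    linarith
  have hs0 : Tendsto (fun n => 1 / √(k n : ℝ)) atTop (𝓝 0) := by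
    simpa only [one_div] using! (Real.tendsto_sqrt_atTop.comp
      (tendsto_natCast_atTop_atTop.comp hk)).inv_tendsto_atTop
  have hr2 : Tendsto (fun n => ε n * w n + 1 / √(k n : ℝ)) atTop (𝓝 0) := by
    have h := hεw.add hs0
    rwa [add_zero] at h
  have hpart2 := hkey (fun n => ε n * w n + 1 / √(k n : ℝ))
    (by
      filter_upwards [hw0, hεpos, hkpos] with n h1 h2 h3
      positivity)
    hr2 1 one_pos
    (by
      filter_upwards [hw0, hsε] with n h1 h2
      rw [add_div, one_mul, add_comm, div_eq_mul_one_div, mul_comm]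
      gcongr)
  refine ⟨fun hcase => ?_, hpart2, hpart2.tendstoInMeasure (by simpa using hr2.sqrt)⟩
  -- A positive lower bound for w absorbs the 1 in 1 + w, so the extra term 1/√k of the general case
  -- can be dropped.
  obtain ⟨c, hc, hcw⟩ := TailPrediction.exists_le_rateWeight hτ01 hτ₀ hcase
  refine hkey (fun n => ε n * w n) ?_ hεw (1 / c + 1) (by positivity) ?_
  · filter_upwards [hcw, hεpos] with n h1 h2
    exact mul_pos h2 (hc.trans_le h1)
  · filter_upwards [hcw, hεpos, hsε] with n h1 h2 h3
    have h4 : 1 + w n ≤ (1 / c + 1) * w n := by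
      have : 1 ≤ 1 / c * w n := by rw [div_mul_eq_mul_div, one_mul, le_div_iff₀ hc]; linarith
      linarith
    have hwn : 0 ≤ w n := hc.le.trans h1
    calc (1 + w n) / √(k n : ℝ) = (1 + w n) * (1 / √(k n : ℝ)) := by rw [mul_one_div]
      _ ≤ ((1 / c + 1) * w n) * ε n := by gcongr
      _ = (1 / c + 1) * (ε n * w n) := by ring
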